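/- Let $L\ge 0$, $K\ge 1$, $M,\tau_p$ be integers; there are $L$ access points (APs) with $M$ antennas, $K$ single-antenna users and one single-antenna eavesdropper $E$ that attacks user $1$. Let $\beta_{l,k}>0$, $\beta_{l,E}\ge 0$, $\rho_u>0$, $\rho_E\ge0$, $\rho_{l,k}\ge 0$, let $\boldsymbol\phi_1,\dots,\boldsymbol\phi_K\in\mathbb C^{\tau_p}$ be orthonormal, and for each AP $l$ let $\mathcal S_l\subseteq\{1,\dots,K\}$ (strong users; the others are weak) satisfy $|\mathcal S_l|<M$. *Channels and training.* $\mathbf h_{l,k}=\sqrt{\beta_{l,k}}\,\mathbf g_{l,k}$ and $\mathbf h_{l,E}=\sqrt{\beta_{l,E}}\,\mathbf g_{l,E}$ in $\mathbb C^M$; AP $l$ receives $$\mathbf Y_l=\sqrt{\tau_p\rho_u}\sum_{k}\mathbf h_{l,k}\boldsymbol\phi_k^{\mathrm H}+\sqrt{\tau_p\rho_E}\,\mathbf h_{l,E}\boldsymbol\phi_1^{\mathrm H}+\mathbf N_l ,$$ where all entries of all $\mathbf g_{l,k},\mathbf g_{l,E},\mathbf N_l$ are i.i.d. $\mathcal{CN}(0,1)$.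 Put $v_{l,k}=\tau_p\rho_u\beta_{l,k}+1$ for $k\ne1$ and $v_{l,1}=\tau_p\rho_u\beta_{l,1}+\tau_p\rho_E\beta_{l,E}+1$. The MMSE channel estimate is $\hat{\mathbf h}_{l,k}=\frac{\sqrt{\tau_p\rho_u}\,\beta_{l,k}}{v_{l,k}}\mathbf Y_l\boldsymbol\phi_k$; put $\gamma_{l,k}=\tau_p\rho_u\beta_{l,k}^2/v_{l,k}$. *PPZF precoding.* Let $\mathbf A_l$ be the matrix with columns $\hat{\mathbf h}_{l,i}$, $i\in\mathcal S_l$. Let $\mathbf u_{l,k}$ be the column of $\mathbf A_l(\mathbf A_l^{\mathrm H}\mathbf A_l)^{-1}$ belonging to $k$ if $k\in\mathcal S_l$ (partial zero-forcing), and $\mathbf u_{l,k}=(\mathbf I_M-\mathbf A_l(\mathbf A_l^{\mathrm H}\mathbf A_l)^{-1}\mathbf A_l^{\mathrm H})\hat{\mathbf h}_{l,k}$ if $k\notin\mathcal S_l$ (protective MRT), and let $\mathbf w_{l,k}=\mathbf u_{l,k}/\sqrt{\mathbb E\|\mathbf u_{l,k}\|^2}$. With data symbols $s_t$, user $k$ receives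 $z_k=\sum_l\mathbf h_{l,k}^{\mathrm H}\sum_t\sqrt{\rho_{l,t}}\,\mathbf w_{l,t}s_t+n_k$. *Spectral efficiency.* Let $\mathrm{UI}_{k,t}=\sum_l\sqrt{\rho_{l,t}}\,\mathbf h_{l,k}^{\mathrm H}\mathbf w_{l,t}$, $\mathrm{CP}_k=\sum_l\sqrt{\rho_{l,k}}\,\mathbb E\{\mathbf h_{l,k}^{\mathrm H}\mathbf w_{l,k}\}$, $\mathrm{PU}_k=\mathrm{UI}_{k,k}-\mathrm{CP}_k$, and $$R_k=\log_2(1+\mathrm{SINR}_k),\qquad \mathrm{SINR}_k=\frac{|\mathrm{CP}_k|^2}{\mathbb E|\mathrm{PU}_k|^2+\sum_{t\ne k}\mathbb E|\mathrm{UI}_{k,t}|^2+1}.$$ **Proposition.** For every user $k$: $\mathbb E\|\mathbf w_{l,t}\|^2=1$ for all $l,t$, all the expectations above exist and are finite, and $$\mathrm{SINR}_k=\frac{\Big(\sum_{l=1}^L\sqrt{(M-|\mathcal S_l|)\,\rho_{l,k}\gamma_{l,k}}\Big)^2}{\sum_{t=1}^K\sum_{l=1}^L\rho_{l,t}(\beta_{l,k}-\delta_{l,k}\gamma_{l,k})+1},$$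 where $\delta_{l,k}=1$ if $k\in\mathcal S_l$ and $\delta_{l,k}=0$ otherwise; hence $R_k$ is $\log_2(1+\cdot)$ of this expression. Moreover $R_k$ is achievable: if $s_k\sim\mathcal{CN}(0,1)$, the symbols satisfy $\mathbb E|s_t|^2=1$ and $\mathbb E\{s_t s_{t'}^*\}=0$ for $t\neq t'$, $n_k\sim\mathcal{CN}(0,1)$, and the symbol vector, $n_k$ and the channels together with the training noise are independent, then the mutual information (in bits) satisfies $I(s_k;z_k)\ge R_k$. -/

import Mathlib

open MeasureTheory ProbabilityTheory Matrix
open scoped ENNReal NNReal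

noncomputable section

namespace CellFree

/-- The law `CN(0, 1)`: real and imaginary parts are independent `N(0, 1/2)`. -/
def stdComplexGaussian : Measure ℂ :=
  ((gaussianReal 0 (1 / 2)).prod (gaussianReal 0 (1 / 2))).map (fun p : ℝ × ℝ => (⟨p.1, p.2⟩ : ℂ))

/-- Deterministic parameters of a network with `L` access points of `M` antennas each,
`K` single-antenna users, one single-antenna eavesdropper and pilots of length `τ`. -/
structure Params (L K M τ : ℕ) where
  /-- large-scale fading coefficient between AP `l` and user `k` -/
  β : Fin L → Fin K → ℝ
  /-- large-scale fading coefficient between AP `l` and the eavesdropper -/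
  βE : Fin L → ℝ
  /-- uplink SNR of the users -/
  ρu : ℝ
  /-- uplink SNR of the eavesdropper -/
  ρE : ℝ
  /-- downlink power control coefficients -/
  ρ : Fin L → Fin K → ℝ
  /-- pilot sequences of the users -/
  φ : Fin K → EuclideanSpace ℂ (Fin τ)
  /-- `S l` is the set of strong users of AP `l`; the weak users are the other ones -/
  S : Fin L → Finset (Fin K)

/-- The random variables of a coherence block that the transmitters' signals depend on:
small-scale fading of the users and of the eavesdropper, and noise in the training phase. -/
structure Block (L K M τ : ℕ) (Ω : Type*) where
  g : Fin L → Fin K → Fin M → Ω → ℂ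
  gE : Fin L → Fin M → Ω → ℂ
  N : Fin L → Fin M → Fin τ → Ω → ℂ

variable {L K M τ : ℕ} {Ω : Type*}

/-- All scalar random variables of a block as a single family. -/
def Block.family (X : Block L K M τ Ω) :
    (Fin L × Fin K × Fin M) ⊕ (Fin L × Fin M) ⊕ (Fin L × Fin M × Fin τ) → Ω → ℂ
  | .inl (l, k, m) => X.g l k m
  | .inr (.inl (l, m)) => X.gE l m
  | .inr (.inr (l, m, i)) => X.N l m i

/-- All small-scale fading coefficients and all training noise samples are
independent and `CN(0, 1)`-distributed. -/
structure Block.IsRayleigh [MeasurableSpace Ω] (X : Block L K M τ Ω) (μ : Measure Ω) : Prop where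
  measurable : ∀ i, Measurable (X.family i)
  law : ∀ i, μ.map (X.family i) = stdComplexGaussian
  indep : iIndepFun X.family μ

namespace Params

variable (P : Params L K M τ) (X : Block L K M τ Ω)

/-- Channel vector between AP `l` and user `k`. -/
def h (l : Fin L) (k : Fin K) (ω : Ω) : Fin M → ℂ :=
  fun m => (√(P.β l k) : ℂ) * X.g l k m ω

/-- Channel vector between AP `l` and the eavesdropper. -/
def hE (l : Fin L) (ω : Ω) : Fin M → ℂ :=
  fun m => (√(P.βE l) : ℂ) * X.gE l m ω

/-- Pilot matrix received by AP `l`. User `0` is the one under attack: the eavesdropper sends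
the pilot of that user. -/
def Y [NeZero K] (l : Fin L) (ω : Ω) : Matrix (Fin M) (Fin τ) ℂ :=
  (√(τ * P.ρu) : ℂ) • ∑ k, vecMulVec (P.h X l k ω) (star (P.φ k).ofLp)
    + (√(τ * P.ρE) : ℂ) • vecMulVec (P.hE X l ω) (star (P.φ 0).ofLp)
    + Matrix.of fun m i => X.N l m i ω

/-- Variance of the signal-plus-noise in the pilot direction of user `k` at AP `l`. -/
def pilotVar [NeZero K] (l : Fin L) (k : Fin K) : ℝ :=
  if k = 0 then τ * P.ρu * P.β l k + τ * P.ρE * P.βE l + 1 else τ * P.ρu * P.β l k + 1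

/-- MMSE estimate of the channel between AP `l` and user `k`. -/
def hhat [NeZero K] (l : Fin L) (k : Fin K) (ω : Ω) : Fin M → ℂ :=
  ((√(τ * P.ρu) * P.β l k / P.pilotVar l k : ℝ) : ℂ) • (P.Y X l ω *ᵥ (P.φ k).ofLp)

/-- Variance of the entries of the channel estimate. -/
def γ [NeZero K] (l : Fin L) (k : Fin K) : ℝ :=
  τ * P.ρu * P.β l k ^ 2 / P.pilotVar l k

/-- Matrix whose columns are the channel estimates of the strong users of AP `l`. -/
def HS [NeZero K] (l : Fin L) (ω : Ω) : Matrix (Fin M) (P.S l) ℂ :=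
  Matrix.of fun m i => P.hhat X l i ω m

/-- Projection onto the orthogonal complement of the estimates of the strong users. -/
def B [NeZero K] (l : Fin L) (ω : Ω) : Matrix (Fin M) (Fin M) ℂ :=
  1 - P.HS X l ω * ((P.HS X l ω)ᴴ * P.HS X l ω)⁻¹ * (P.HS X l ω)ᴴ

/-- Precoding vector before normalization: partial zero-forcing for a strong user of AP `l`,
protective maximum-ratio transmission for a weak user. -/
def u [NeZero K] (l : Fin L) (k : Fin K) (ω : Ω) : Fin M → ℂ :=
  if hk : k ∈ P.S l then
    (P.HS X l ω * ((P.HS X l ω)ᴴ * P.HS X l ω)⁻¹) *ᵥ Pi.single ⟨k, hk⟩ 1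
  else
    P.B X l ω *ᵥ P.hhat X l k ω

variable [MeasurableSpace Ω] (μ : Measure Ω)

/-- PPZF precoding vector of AP `l` for user `k`. -/
def w [NeZero K] (l : Fin L) (k : Fin K) (ω : Ω) : Fin M → ℂ :=
  ((1 / √(∫ ω', ∑ m, ‖P.u X l k ω' m‖ ^ 2 ∂μ) : ℝ) : ℂ) • P.u X l k ω

/-- Signal sent by AP `l` when the data symbols are `s`. -/
def x [NeZero K] (s : Fin K → Ω → ℂ) (l : Fin L) (ω : Ω) : Fin M → ℂ :=
  ∑ t, ((√(P.ρ l t) : ℂ) * s t ω) • P.w X μ l t ω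

/-- Signal received by user `k`, whose receiver noise is `n`. -/
def z [NeZero K] (s : Fin K → Ω → ℂ) (n : Ω → ℂ) (k : Fin K) (ω : Ω) : ℂ :=
  ∑ l, star (P.h X l k ω) ⬝ᵥ P.x X μ s l ω + n ω

/-- Coherent precoding gain of user `k`. -/
def CP [NeZero K] (k : Fin K) : ℂ :=
  ∑ l, (√(P.ρ l k) : ℂ) * ∫ ω, star (P.h X l k ω) ⬝ᵥ P.w X μ l k ω ∂μ

/-- Precoding gain uncertainty of user `k`. -/
def PU [NeZero K] (k : Fin K) (ω : Ω) : ℂ :=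
  ∑ l, ((√(P.ρ l k) : ℂ) * (star (P.h X l k ω) ⬝ᵥ P.w X μ l k ω)
    - (√(P.ρ l k) : ℂ) * ∫ ω', star (P.h X l k ω') ⬝ᵥ P.w X μ l k ω' ∂μ)

/-- Interference at user `k` from the signal intended for user `t`. -/
def UI [NeZero K] (k t : Fin K) (ω : Ω) : ℂ :=
  ∑ l, (√(P.ρ l t) : ℂ) * (star (P.h X l k ω) ⬝ᵥ P.w X μ l t ω)

/-- Effective SINR of user `k`, who only has statistical channel knowledge. -/
def SINR [NeZero K] (k : Fin K) : ℝ :=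
  ‖P.CP X μ k‖ ^ 2 /
    ((∫ ω, ‖P.PU X μ k ω‖ ^ 2 ∂μ)
      + (∑ t ∈ Finset.univ.erase k, ∫ ω, ‖P.UI X μ k t ω‖ ^ 2 ∂μ) + 1)

/-- Downlink spectral efficiency of user `k` in bit/s/Hz. -/
def SE [NeZero K] (k : Fin K) : ℝ := Real.logb 2 (1 + P.SINR X μ k)

/-- Indicator of `k` being a strong user of AP `l`. -/
def δ (l : Fin L) (k : Fin K) : ℝ := if k ∈ P.S l then 1 else 0

end Params

/-- Mutual information between two random variables, in bits. -/
def mutualInfo [MeasurableSpace Ω] {A C : Type*} [MeasurableSpace A] [MeasurableSpace C]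
    (U : Ω → A) (V : Ω → C) (μ : Measure Ω) : ℝ≥0∞ :=
  InformationTheory.klDiv (μ.map fun ω => (U ω, V ω)) ((μ.map U).prod (μ.map V))
    / ENNReal.ofReal (Real.log 2)

/-- The data symbols `s` and the noise `n` of user `k`: the symbols have unit power and are
mutually uncorrelated, the symbol of user `k` is `CN(0, 1)`, the noise is `CN(0, 1)`, and symbols,
noise and the random variables of the block are independent of one another. -/
structure IsDownlinkInput [MeasurableSpace Ω] (X : Block L K M τ Ω) (μ : Measure Ω)
    (k : Fin K) (s : Fin K → Ω → ℂ) (n : Ω → ℂ) : Prop where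
  measurable_s : ∀ t, Measurable (s t)
  measurable_n : Measurable n
  power : ∀ t, ∫ ω, ‖s t ω‖ ^ 2 ∂μ = 1
  uncorrelated : ∀ t t', t ≠ t' → ∫ ω, s t ω * star (s t' ω) ∂μ = 0
  law_s : μ.map (s k) = stdComplexGaussian
  law_n : μ.map n = stdComplexGaussian
  indep_s : IndepFun (fun ω t => s t ω) (fun ω i => X.family i ω) μ
  indep_n : IndepFun n (fun ω => ((fun t => s t ω), (fun i => X.family i ω))) μ

end CellFree

end

noncomputable section

namespace CellFree

-- The SINR formula rests on three facts about a single AP. First, the pilots are orthonormal, so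
-- projecting the training signal onto each pilot makes the estimates independent scaled Gaussian
-- vectors. The MMSE error of user `k` is one more Gaussian vector, independent of all of them
-- (`Params.exists_gaussian_representation`). The contaminated pilot changes only a variance.
--
-- Second, for an orthogonal projection `B` of rank `r` and a standard complex Gaussian `x`, the
-- form `x* B x` is a sum of `r` independent squared moduli
-- (`exists_lintegral_quadForm_projection`). Its mean is `r`, its second moment `r(r+1)`, and its
-- inverse mean `1/(r-1)` for `r ≥ 2`. Put `n = M - |S|`. A protective MRT vector is a rank-`n`
-- projection of a Gaussian vector. The squared norm of a zero-forcing vector is the inverse of such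
-- a form of rank `n+1` (`colMatrix_mul_gram_inv_mulVec_single`). This gives both normalizations.
--
-- Third, the gain `h* w` splits into the estimated gain and an uncorrelated error term of power `β
-- - γ` (`gain_of_estimated_gain`). For a strong user the estimated gain is almost surely constant.
-- A weak user's own gain is a quadratic form of variance `γ` after normalization. For a weak user
-- and another user's precoder, the precoder is independent of the whole channel. In every case the
-- gain has variance `β - δγ`, and mean `√(γ n)` or `0` according to whether the signal is the
-- user's own (`Params.IsValid.gain`). Distinct APs are independent, so the variances add up.
--
-- For achievability, `ofReal_log_le_klDiv` applies the variational lower bound for the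
-- Kullback-Leibler divergence. The test function is the log-likelihood ratio of the Gaussian law of
-- the symbol around its linear MMSE estimate to its prior law. Its mean depends only on second
-- moments, which is why uncorrelated symbols suffice.

-- Moments and characteristic function of `CN(0, 1)`.

instance : IsProbabilityMeasure stdComplexGaussian := by
  unfold stdComplexGaussian
  exact Measure.isProbabilityMeasure_map
    (Complex.measurableEquivRealProd.symm.measurable.aemeasurable)

/-- The density of `CN(0, 1)` with respect to Lebesgue measure. -/
lemma stdComplexGaussian_eq_withDensity :
    stdComplexGaussian
      = volume.withDensity fun z : ℂ => ENNReal.ofReal (Real.pi⁻¹ * Real.exp (-‖z‖ ^ 2)) := by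
  have hv : (1 / 2 : ℝ≥0) ≠ 0 := by norm_num
  have hmp := Complex.volume_preserving_equiv_real_prod.symm
  unfold stdComplexGaussian
  rw [gaussianReal_of_var_ne_zero _ hv, prod_withDensity (by fun_prop) (by fun_prop)]
  ext s hs
  have hm : Measurable (fun p : ℝ × ℝ => (⟨p.1, p.2⟩ : ℂ)) :=
    Complex.measurableEquivRealProd.symm.measurable
  rw [Measure.map_apply hm hs, withDensity_apply _ (hm hs), withDensity_apply _ hs,
    ← hmp.setLIntegral_comp_preimage hs (by fun_prop)]
  refine lintegral_congr fun p => ?_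
  rw [gaussianPDF, gaussianPDF, ← ENNReal.ofReal_mul (gaussianPDFReal_nonneg _ _ _)]
  congr 1
  simp only [gaussianPDFReal, Complex.measurableEquivRealProd_symm_apply]
  have h2 : √(2 * Real.pi * ((1 / 2 : ℝ≥0) : ℝ)) = √Real.pi := by
    congr 1; push_cast; ring
  rw [h2, mul_mul_mul_comm, ← Real.exp_add, ← mul_inv, Real.mul_self_sqrt Real.pi_pos.le,
    Complex.sq_norm, Complex.normSq_mk]
  congr 2
  push_cast
  ring

lemma lintegral_stdComplexGaussian {f : ℂ → ℝ≥0∞} (hf : Measurable f) :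
    ∫⁻ z, f z ∂stdComplexGaussian
      = ∫⁻ z, ENNReal.ofReal (Real.pi⁻¹ * Real.exp (-‖z‖ ^ 2)) * f z := by
  rw [stdComplexGaussian_eq_withDensity, lintegral_withDensity_eq_lintegral_mul _ (by fun_prop) hf]
  rfl

lemma lintegral_norm_pow_mul_exp (n : ℕ) {b : ℝ} (hb : 0 < b) :
    ∫⁻ z : ℂ, ENNReal.ofReal (‖z‖ ^ (2 * n) * Real.exp (-b * ‖z‖ ^ 2))
      = ENNReal.ofReal (Real.pi * n.factorial / b ^ (n + 1)) := by
  have h := Complex.integral_rpow_mul_exp_neg_mul_rpow (p := 2) (q := 2 * n) (by norm_num)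
    (by linarith [(Nat.cast_nonneg n : (0 : ℝ) ≤ n)]) hb
  have h1 : -((2 * n : ℝ) + 2) / 2 = -((n + 1 : ℕ) : ℝ) := by push_cast; ring
  have h2 : ((2 * n : ℝ) + 2) / 2 = n + 1 := by ring
  rw [h1, h2, Real.Gamma_nat_eq_factorial, Real.rpow_neg hb.le, Real.rpow_natCast] at h
  have h3 : ∀ z : ℂ, ‖z‖ ^ (2 * n : ℝ) * Real.exp (-b * ‖z‖ ^ (2 : ℝ))
      = ‖z‖ ^ (2 * n) * Real.exp (-b * ‖z‖ ^ 2) := fun z => by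
    rw [Real.rpow_two, ← Real.rpow_natCast ‖z‖ (2 * n)]; push_cast; rfl
  simp_rw [h3] at h
  have hpos : (2 * Real.pi / 2 * (b ^ (n + 1))⁻¹ * n.factorial : ℝ) ≠ 0 := by positivity
  rw [← ofReal_integral_eq_lintegral_ofReal _ (.of_forall fun z => by positivity), h]
  · congr 1; field_simp
  -- Integrability comes for free: a non-integrable function has integral `0` by convention, while
  -- `h` gives a positive value.
  · by_contra hi
    rw [integral_undef hi] at h
    exact hpos h.symm

/-- The Gaussian density merely shifts the rate to `1 + t`. The case `t = 0` gives the moments of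
the squared modulus, and `n = 0` its Laplace transform, from which the inverse moment is later
recovered. -/
lemma lintegral_norm_pow_mul_exp_stdComplexGaussian (n : ℕ) {t : ℝ} (ht : 0 ≤ t) :
    ∫⁻ z, ENNReal.ofReal (‖z‖ ^ (2 * n) * Real.exp (-t * ‖z‖ ^ 2)) ∂stdComplexGaussian
      = ENNReal.ofReal (n.factorial / (1 + t) ^ (n + 1)) := by
  rw [lintegral_stdComplexGaussian (by fun_prop)]
  have h : ∀ z : ℂ, ENNReal.ofReal (Real.pi⁻¹ * Real.exp (-‖z‖ ^ 2))
        * ENNReal.ofReal (‖z‖ ^ (2 * n) * Real.exp (-t * ‖z‖ ^ 2))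
      = ENNReal.ofReal Real.pi⁻¹ *
        ENNReal.ofReal (‖z‖ ^ (2 * n) * Real.exp (-(1 + t) * ‖z‖ ^ 2)) := fun z => by
    rw [← ENNReal.ofReal_mul (by positivity), ← ENNReal.ofReal_mul (by positivity)]
    congr 1
    rw [show -(1 + t) * ‖z‖ ^ 2 = -‖z‖ ^ 2 + -t * ‖z‖ ^ 2 by ring, Real.exp_add]
    ring
  simp_rw [h]
  rw [lintegral_const_mul _ (by fun_prop), lintegral_norm_pow_mul_exp n (by positivity),
    ← ENNReal.ofReal_mul (by positivity)]
  congr 1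
  field_simp

lemma lintegral_norm_pow_stdComplexGaussian (n : ℕ) :
    ∫⁻ z, ENNReal.ofReal (‖z‖ ^ (2 * n)) ∂stdComplexGaussian = ENNReal.ofReal n.factorial := by
  simpa using lintegral_norm_pow_mul_exp_stdComplexGaussian n le_rfl

lemma memLp_id_stdComplexGaussian : MemLp (fun z : ℂ => z) 2 stdComplexGaussian := by
  rw [memLp_two_iff_integrable_sq_norm (by fun_prop)]
  refine ⟨by fun_prop, ?_⟩
  rw [hasFiniteIntegral_iff_ofReal (.of_forall fun z => by positivity)]
  have := lintegral_norm_pow_stdComplexGaussian 1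
  simp only [mul_one] at this
  rw [this]; exact ENNReal.ofReal_lt_top

lemma integral_norm_sq_stdComplexGaussian : ∫ z, ‖z‖ ^ 2 ∂stdComplexGaussian = 1 := by
  rw [integral_eq_lintegral_of_nonneg_ae (.of_forall fun z => by positivity) (by fun_prop)]
  have := lintegral_norm_pow_stdComplexGaussian 1
  simp only [mul_one] at this
  rw [this]; simp

/-- A real-linear functional on `ℂ` is determined by its values at `1` and `I`; these multiply
independent real Gaussians of variance `1/2`, whence the factor `1/4`. -/
lemma charFunDual_stdComplexGaussian (L : StrongDual ℝ ℂ) :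
    charFunDual stdComplexGaussian L = Complex.exp (-((L 1) ^ 2 + (L Complex.I) ^ 2 : ℝ) / 4) := by
  have h : stdComplexGaussian = ((gaussianReal 0 (1 / 2)).prod (gaussianReal 0 (1 / 2))).map
      (Complex.equivRealProdCLM.symm : ℝ × ℝ →L[ℝ] ℂ) := rfl
  rw [h, charFunDual_map, charFunDual_prod, charFunDual_eq_charFun_map_one,
    charFunDual_eq_charFun_map_one]
  have e1 : ⇑((L.comp (Complex.equivRealProdCLM.symm : ℝ × ℝ →L[ℝ] ℂ)).comp
      (.inl ℝ ℝ ℝ)) = fun x => L 1 * x := by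
    funext x
    have : (⟨x, 0⟩ : ℂ) = x • (1 : ℂ) := by apply Complex.ext <;> simp
    change L (⟨x, 0⟩ : ℂ) = _
    rw [this, map_smul, smul_eq_mul, mul_comm]
  have e2 : ⇑((L.comp (Complex.equivRealProdCLM.symm : ℝ × ℝ →L[ℝ] ℂ)).comp
      (.inr ℝ ℝ ℝ)) = fun x => L Complex.I * x := by
    funext x
    have : (⟨0, x⟩ : ℂ) = x • Complex.I := by apply Complex.ext <;> simp
    change L (⟨0, x⟩ : ℂ) = _
    rw [this, map_smul, smul_eq_mul, mul_comm]
  rw [e1, e2, gaussianReal_map_const_mul, gaussianReal_map_const_mul, charFun_gaussianReal,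
    charFun_gaussianReal, ← Complex.exp_add]
  congr 1
  push_cast
  simp
  ring

/-- The characteristic function is even, so the law is symmetric. -/
lemma integral_id_stdComplexGaussian : ∫ z, z ∂stdComplexGaussian = 0 := by
  have hneg : stdComplexGaussian.map (fun z => -z) = stdComplexGaussian := by
    have : IsProbabilityMeasure (stdComplexGaussian.map (fun z => -z)) :=
      Measure.isProbabilityMeasure_map (by fun_prop)
    refine Measure.ext_of_charFunDual (funext fun L => ?_)
    change charFunDual (stdComplexGaussian.map (-ContinuousLinearMap.id ℝ ℂ)) L = _
    rw [charFunDual_map]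
    simp [charFunDual_stdComplexGaussian]
  have h : ∫ z, z ∂stdComplexGaussian = -∫ z, z ∂stdComplexGaussian := by
    conv_lhs => rw [← hneg]
    rw [integral_map (by fun_prop) (by fun_prop), integral_neg]
  exact self_eq_neg.mp h

-- Invariance of Gaussian vectors under maps with orthonormal rows.

lemma ofReal_sum_normSq {ι : Type*} [Fintype ι] (c : ι → ℂ) :
    ((∑ i, Complex.normSq (c i) : ℝ) : ℂ) = c ⬝ᵥ star c := by
  simp [dotProduct, Complex.mul_conj]

/-- A matrix with orthonormal rows maps a vector of independent `CN(0, 1)` entries to such a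
vector. -/
lemma map_mulVec_pi_stdComplexGaussian {ι κ : Type*} [Fintype ι] [Fintype κ] [DecidableEq κ]
    (V : Matrix κ ι ℂ) (hV : V * Vᴴ = 1) :
    (Measure.pi fun _ : ι => stdComplexGaussian).map (fun x => V *ᵥ x)
      = Measure.pi fun _ : κ => stdComplexGaussian := by
  classical
  have hlin : (fun x : ι → ℂ => V *ᵥ x)
      = ⇑((LinearMap.toContinuousLinearMap V.mulVecLin).restrictScalars ℝ) := rfl
  have : IsProbabilityMeasure
      ((Measure.pi fun _ : ι => stdComplexGaussian).map (fun x => V *ᵥ x)) :=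
    Measure.isProbabilityMeasure_map (by rw [hlin]; fun_prop)
  refine Measure.ext_of_charFunDual (funext fun L => ?_)
  rw [hlin, charFunDual_map, charFunDual_pi, charFunDual_pi]
  simp_rw [charFunDual_stdComplexGaussian, ← Complex.exp_sum, ← Finset.sum_div,
    Finset.sum_neg_distrib, ← Complex.ofReal_sum]
  congr 4
  -- The vector `d` represents `L` as `v ↦ Re (d* v)`. Both exponents then become squared norms, of
  -- `d* V` and of `d*`, and these agree because `V Vᴴ = 1`.
  set d : κ → ℂ := fun a => ⟨L (Pi.single a 1), L (Pi.single a Complex.I)⟩ with hd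
  have hLs : ∀ (a : κ) (z : ℂ), L (Pi.single a z) = (star (d a) * z).re := by
    intro a z
    have : (Pi.single a z : κ → ℂ) =
        z.re • (Pi.single a 1 : κ → ℂ) + z.im • (Pi.single a Complex.I : κ → ℂ) := by
      rw [← Pi.single_smul, ← Pi.single_smul, ← Pi.single_add]
      congr 1
      apply Complex.ext <;> simp
    rw [this, map_add, map_smul, map_smul]
    simp [hd]; ring
  have hL : ∀ v : κ → ℂ, L v = (star d ⬝ᵥ v).re := by
    intro v
    conv_lhs => rw [← Finset.univ_sum_single v]
    rw [map_sum, dotProduct, Complex.re_sum]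
    exact Finset.sum_congr rfl fun a _ => hLs a (v a)
  have hnorm : ∀ c : ℂ, c.re ^ 2 + (c * Complex.I).re ^ 2 = Complex.normSq c := by
    intro c; simp [Complex.normSq_apply]; ring
  have lhs : ∀ i, (((L.comp ((LinearMap.toContinuousLinearMap V.mulVecLin).restrictScalars ℝ)).comp
      (.single ℝ (fun _ => ℂ) i)) 1) ^ 2
      + (((L.comp ((LinearMap.toContinuousLinearMap V.mulVecLin).restrictScalars ℝ)).comp
      (.single ℝ (fun _ => ℂ) i)) Complex.I) ^ 2 = Complex.normSq ((star d ᵥ* V) i) := by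
    intro i
    rw [← hnorm]
    have key : ∀ z : ℂ, ((L.comp ((LinearMap.toContinuousLinearMap V.mulVecLin).restrictScalars
        ℝ)).comp (.single ℝ (fun _ => ℂ) i)) z = ((star d ᵥ* V) i * z).re := by
      intro z
      change L (V *ᵥ Pi.single i z) = _
      rw [hL, dotProduct_mulVec, dotProduct_single]
    rw [key, key, mul_one]
  have rhs : ∀ a, ((L.comp (.single ℝ (fun _ => ℂ) a)) 1) ^ 2
      + ((L.comp (.single ℝ (fun _ => ℂ) a)) Complex.I) ^ 2 = Complex.normSq (star d a) := by
    intro a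
    rw [← hnorm]
    have key : ∀ z : ℂ, (L.comp (.single ℝ (fun _ => ℂ) a)) z = (star d a * z).re :=
      fun z => hLs a z
    rw [key, key, mul_one]
  simp_rw [lhs, rhs]
  rw [← Complex.ofReal_inj, ofReal_sum_normSq, ofReal_sum_normSq, star_vecMul, ← dotProduct_mulVec, mulVec_mulVec, hV,
    one_mulVec]

-- Quadratic forms of projections at Gaussian vectors.

/-- Law of a vector of `n` independent `CN(0, 1)` entries. -/
abbrev stdComplexGaussianVec (ι : Type*) [Fintype ι] : Measure (ι → ℂ) :=
  Measure.pi fun _ => stdComplexGaussian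

/-- The quadratic form of a Hermitian matrix, as a real number. -/
def quadForm {ι : Type*} [Fintype ι] (B : Matrix ι ι ℂ) (x : ι → ℂ) : ℝ :=
  (star x ⬝ᵥ B *ᵥ x).re

@[fun_prop]
lemma continuous_quadForm {ι : Type*} [Fintype ι] (B : Matrix ι ι ℂ) :
    Continuous (quadForm B) := by
  unfold quadForm; fun_prop

lemma quadForm_smul {ι : Type*} [Fintype ι] (B : Matrix ι ι ℂ) (c : ℝ) (x : ι → ℂ) :
    quadForm B ((c : ℂ) • x) = c ^ 2 * quadForm B x := by
  have : star x ⬝ᵥ (↑c : ℂ) • ((↑c : ℂ) • B *ᵥ x) = ((c ^ 2 : ℝ) : ℂ) * (star x ⬝ᵥ B *ᵥ x) := by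
    simp only [dotProduct_smul, smul_eq_mul]; push_cast; ring
  simp only [quadForm, star_smul, mulVec_smul, smul_dotProduct]
  rw [← dotProduct_smul, Complex.star_def, Complex.conj_ofReal, this, Complex.re_ofReal_mul]

lemma quadForm_eq_sum_eigenvalues {ι : Type*} [Fintype ι] [DecidableEq ι] {B : Matrix ι ι ℂ}
    (hB : B.IsHermitian) (x : ι → ℂ) :
    quadForm B x
      = ∑ i, hB.eigenvalues i *
          ‖((star (hB.eigenvectorUnitary : Matrix ι ι ℂ)) *ᵥ x) i‖ ^ 2 := by
  set U : Matrix ι ι ℂ := (hB.eigenvectorUnitary : Matrix ι ι ℂ) with hU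
  have hs : B = U * diagonal (RCLike.ofReal ∘ hB.eigenvalues) * star U := by
    conv_lhs => rw [hB.spectral_theorem]
    simp [Unitary.conjStarAlgAut_apply, hU]
  have h1 : star x ⬝ᵥ B *ᵥ x
      = star (star U *ᵥ x) ⬝ᵥ diagonal (RCLike.ofReal ∘ hB.eigenvalues) *ᵥ (star U *ᵥ x) := by
    conv_lhs => rw [hs, ← mulVec_mulVec, ← mulVec_mulVec, dotProduct_mulVec]
    rw [star_mulVec, star_eq_conjTranspose, conjTranspose_conjTranspose]
  rw [quadForm, h1, dotProduct, Complex.re_sum]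
  refine Finset.sum_congr rfl fun i _ => ?_
  rw [mulVec_diagonal, Pi.star_apply, mul_left_comm, Complex.star_def, Complex.conj_mul']
  rw [← Complex.ofReal_pow]
  exact (Complex.re_ofReal_mul _ _).trans (by rw [Complex.ofReal_re]; rfl)

/-- For an orthogonal projection `B` of rank `n`, the law of the quadratic form of `B` at a
standard complex Gaussian vector is that of the squared norm of `n` of its entries. -/
lemma exists_lintegral_quadForm_projection {ι : Type*} [Fintype ι] [DecidableEq ι]
    {B : Matrix ι ι ℂ} (hB : B.IsHermitian) (hB2 : B * B = B) {n : ℕ} (hn : B.trace = n) :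
    ∃ E : Finset ι, E.card = n ∧ ∀ F : ℝ → ℝ≥0∞, Measurable F →
      ∫⁻ x, F (quadForm B x) ∂(stdComplexGaussianVec ι)
        = ∫⁻ y, F (∑ i ∈ E, ‖y i‖ ^ 2) ∂(stdComplexGaussianVec ι) := by
  have h01 : ∀ i, hB.eigenvalues i = 0 ∨ hB.eigenvalues i = 1 := by
    intro i
    have hv := hB.mulVec_eigenvectorBasis i
    have hv2 : B *ᵥ (B *ᵥ ⇑(hB.eigenvectorBasis i)) = B *ᵥ ⇑(hB.eigenvectorBasis i) := by
      rw [mulVec_mulVec, hB2]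
    rw [hv, mulVec_smul, hv, smul_smul] at hv2
    have hne : (⇑(hB.eigenvectorBasis i) : ι → ℂ) ≠ 0 := by
      have := hB.eigenvectorBasis.orthonormal.ne_zero i
      intro h
      exact this (by ext j; exact congrFun h j)
    have := smul_left_injective ℝ hne hv2
    have h2 : hB.eigenvalues i * (hB.eigenvalues i - 1) = 0 := by linarith
    rcases mul_eq_zero.mp h2 with h | h
    · exact .inl h
    · exact .inr (by linarith)
  classical
  -- All eigenvalues are `0` or `1`, so the trace counts the eigenvalues equal to `1`.
  refine ⟨Finset.univ.filter fun i => hB.eigenvalues i = 1, ?_, fun F hF => ?_⟩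
  · have ht := hB.trace_eq_sum_eigenvalues
    rw [hn] at ht
    have : (n : ℝ) = ∑ i, hB.eigenvalues i := by
      have := congrArg Complex.re ht
      simpa using this
    have h2 : ∑ i, hB.eigenvalues i = ∑ i, if hB.eigenvalues i = 1 then (1 : ℝ) else 0 :=
      Finset.sum_congr rfl fun i _ => by rcases h01 i with h | h <;> simp [h]
    rw [h2, Finset.sum_boole] at this
    exact_mod_cast this.symm
  · have hU : (star (hB.eigenvectorUnitary : Matrix ι ι ℂ))
        * (star (hB.eigenvectorUnitary : Matrix ι ι ℂ))ᴴ = 1 := by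
      rw [← star_eq_conjTranspose, star_star]
      exact Unitary.coe_star_mul_self _
    -- Passing to coordinates in the eigenbasis preserves the Gaussian law.
    conv_rhs => rw [stdComplexGaussianVec, ← map_mulVec_pi_stdComplexGaussian _ hU]
    rw [lintegral_map (by fun_prop) (by fun_prop)]
    refine lintegral_congr fun x => ?_
    rw [quadForm_eq_sum_eigenvalues hB, Finset.sum_filter]
    congr 1
    refine Finset.sum_congr rfl fun i _ => ?_
    rcases h01 i with h | h <;> simp [h]

-- First, second and inverse moments of a sum of squared moduli.

lemma lintegral_eval_stdComplexGaussianVec {ι : Type*} [Fintype ι] (i : ι) {f : ℂ → ℝ≥0∞}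
    (hf : Measurable f) :
    ∫⁻ y, f (y i) ∂(stdComplexGaussianVec ι) = ∫⁻ z, f z ∂stdComplexGaussian :=
  (measurePreserving_eval (fun _ : ι => stdComplexGaussian) i).lintegral_comp hf

lemma lintegral_eval_mul_eval_stdComplexGaussianVec {ι : Type*} [Fintype ι] {i j : ι} (hij : i ≠ j)
    {f g : ℂ → ℝ≥0∞} (hf : Measurable f) (hg : Measurable g) :
    ∫⁻ y, f (y i) * g (y j) ∂(stdComplexGaussianVec ι)
      = (∫⁻ z, f z ∂stdComplexGaussian) * ∫⁻ z, g z ∂stdComplexGaussian := by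
  have hi := (iIndepFun_pi (μ := fun _ : ι => stdComplexGaussian) (X := fun _ z => z)
    (fun _ => by fun_prop)).indepFun hij
  have h := lintegral_mul_eq_lintegral_mul_lintegral_of_indepFun''
    (hf.comp (measurable_pi_apply i)).aemeasurable (hg.comp (measurable_pi_apply j)).aemeasurable
    (hi.comp hf hg)
  simp only [Function.comp_apply] at h
  rw [h, lintegral_eval_stdComplexGaussianVec i hf,
    lintegral_eval_stdComplexGaussianVec j hg]

lemma lintegral_sum_norm_sq_stdComplexGaussianVec {ι : Type*} [Fintype ι] (E : Finset ι) :
    ∫⁻ y, ENNReal.ofReal (∑ i ∈ E, ‖y i‖ ^ 2) ∂(stdComplexGaussianVec ι) = E.card := by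
  have h1 := lintegral_norm_pow_stdComplexGaussian 1
  simp only [mul_one, Nat.factorial_one, Nat.cast_one, ENNReal.ofReal_one] at h1
  simp_rw [ENNReal.ofReal_sum_of_nonneg fun (i : ι) _ => sq_nonneg _]
  rw [lintegral_finsetSum _ (by fun_prop)]
  simp_rw [fun i : ι => lintegral_eval_stdComplexGaussianVec i
    (f := fun z => ENNReal.ofReal (‖z‖ ^ 2)) (by fun_prop), h1]
  simp

/-- In the expanded square each off-diagonal pair contributes `1` by independence and each diagonal
pair the fourth absolute moment `2`. -/
lemma lintegral_sum_norm_sq_sq_stdComplexGaussianVec {ι : Type*} [Fintype ι] (E : Finset ι) :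
    ∫⁻ y, ENNReal.ofReal ((∑ i ∈ E, ‖y i‖ ^ 2) ^ 2) ∂(stdComplexGaussianVec ι)
      = E.card * (E.card + 1) := by
  classical
  have h1 := lintegral_norm_pow_stdComplexGaussian 1
  have h2 := lintegral_norm_pow_stdComplexGaussian 2
  simp only [mul_one, Nat.factorial_one, Nat.cast_one, ENNReal.ofReal_one] at h1
  have hx : ∀ y : ι → ℂ, ENNReal.ofReal ((∑ i ∈ E, ‖y i‖ ^ 2) ^ 2)
      = ∑ i ∈ E, ∑ j ∈ E, ENNReal.ofReal (‖y i‖ ^ 2) * ENNReal.ofReal (‖y j‖ ^ 2) := fun y => by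
    rw [ENNReal.ofReal_pow (Finset.sum_nonneg fun i _ => sq_nonneg _),
      ENNReal.ofReal_sum_of_nonneg fun (i : ι) _ => sq_nonneg _, sq, Finset.sum_mul_sum]
  have hij : ∀ i j : ι, ∫⁻ y, ENNReal.ofReal (‖y i‖ ^ 2) * ENNReal.ofReal (‖y j‖ ^ 2)
      ∂(stdComplexGaussianVec ι) = 1 + if i = j then 1 else 0 := fun i j => by
    split_ifs with h
    · subst h
      rw [← lintegral_eval_stdComplexGaussianVec i (by fun_prop)] at h2
      simp_rw [← ENNReal.ofReal_mul (sq_nonneg _), ← pow_add]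
      rw [h2]
      norm_num
    · rw [lintegral_eval_mul_eval_stdComplexGaussianVec h (f := fun z => ENNReal.ofReal (‖z‖ ^ 2))
        (g := fun z => ENNReal.ofReal (‖z‖ ^ 2)) (by fun_prop) (by fun_prop), h1]
      simp
  simp_rw [hx]
  rw [lintegral_finsetSum _ (by fun_prop)]
  have hs : ∀ i, ∫⁻ y : ι → ℂ, ∑ j ∈ E, ENNReal.ofReal (‖y i‖ ^ 2) * ENNReal.ofReal (‖y j‖ ^ 2)
      ∂(stdComplexGaussianVec ι) = ∑ j ∈ E, (1 + if i = j then 1 else 0) := fun i => by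
    rw [lintegral_finsetSum _ (by fun_prop)]
    exact Finset.sum_congr rfl fun j _ => hij i j
  simp_rw [hs, Finset.sum_add_distrib, Finset.sum_ite_eq]
  rw [Finset.sum_ite_mem]
  simp [mul_add]

lemma lintegral_exp_neg_sum_norm_sq_stdComplexGaussianVec {ι : Type*} [Fintype ι] (E : Finset ι)
    {t : ℝ} (ht : 0 ≤ t) :
    ∫⁻ y, ENNReal.ofReal (Real.exp (-t * ∑ i ∈ E, ‖y i‖ ^ 2)) ∂(stdComplexGaussianVec ι)
      = ENNReal.ofReal ((1 + t) ^ E.card)⁻¹ := by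
  have h0 := lintegral_norm_pow_mul_exp_stdComplexGaussian 0 ht
  simp only [mul_zero, pow_zero, one_mul, Nat.factorial_zero, Nat.cast_one, zero_add,
    pow_one] at h0
  have hx : ∀ y : ι → ℂ, ENNReal.ofReal (Real.exp (-t * ∑ i ∈ E, ‖y i‖ ^ 2))
      = ∏ i ∈ E, ENNReal.ofReal (Real.exp (-t * ‖y i‖ ^ 2)) := fun y => by
    rw [← ENNReal.ofReal_prod_of_nonneg fun i _ => (Real.exp_pos _).le, Finset.mul_sum,
      Real.exp_sum]
  simp_rw [hx]
  have hi := iIndepFun_pi (μ := fun _ : ι => stdComplexGaussian)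
    (X := fun _ z => ENNReal.ofReal (Real.exp (-t * ‖z‖ ^ 2))) (fun _ => by fun_prop)
  rw [lintegral_prod_eq_prod_lintegral_of_indepFun E _ hi (by fun_prop)]
  simp_rw [fun i : ι => lintegral_eval_stdComplexGaussianVec i
    (f := fun z => ENNReal.ofReal (Real.exp (-t * ‖z‖ ^ 2))) (by fun_prop), h0]
  rw [Finset.prod_const, ← ENNReal.ofReal_pow (by positivity)]
  simp

/-- This turns an inverse moment into an integral of Laplace transforms. At `r = 0` both sides are
`∞`, so no case has to be excluded under the expectation. -/
lemma inv_ofReal_eq_lintegral_exp {r : ℝ} (hr : 0 ≤ r) :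
    (ENNReal.ofReal r)⁻¹ = ∫⁻ t in Set.Ioi (0 : ℝ), ENNReal.ofReal (Real.exp (-t * r)) := by
  rcases hr.eq_or_lt with rfl | hr
  · simp
  · have h : ∀ t : ℝ, -t * r = -r * t := fun t => by ring
    simp_rw [h]
    rw [← ofReal_integral_eq_lintegral_ofReal _ (.of_forall fun t => (Real.exp_pos _).le),
      integral_exp_mul_Ioi (by linarith), ← ENNReal.ofReal_inv_of_pos hr]
    · simp
    · exact (exp_neg_integrableOn_Ioi 0 hr)

lemma lintegral_Ioi_inv_one_add_pow (m : ℕ) :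
    ∫⁻ t in Set.Ioi (0 : ℝ), ENNReal.ofReal ((1 + t) ^ (m + 2))⁻¹
      = ENNReal.ofReal (1 / (m + 1)) := by
  have hd : ∀ t ∈ Set.Ioi (0 : ℝ), HasDerivAt (fun t : ℝ => -((m + 1) * (1 + t) ^ (m + 1))⁻¹)
      ((1 + t) ^ (m + 2))⁻¹ t := by
    intro t ht
    have ht : 0 < 1 + t := by have := Set.mem_Ioi.mp ht; linarith
    have h := ((((hasDerivAt_id t).const_add 1).pow (m + 1)).const_mul ((m : ℝ) + 1)).inv
      (by simp only [Pi.pow_apply, id]; positivity)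
    refine (h.neg).congr_deriv ?_
    simp only [Pi.pow_apply, id]
    push_cast
    field_simp
    ring
  have hc : ContinuousWithinAt (fun t : ℝ => -((m + 1) * (1 + t) ^ (m + 1))⁻¹) (Set.Ici 0) 0 := by
    refine ContinuousAt.continuousWithinAt ?_
    refine (ContinuousAt.inv₀ (by fun_prop) ?_).neg
    simp; positivity
  have hlim : Filter.Tendsto (fun t : ℝ => -((m + 1) * (1 + t) ^ (m + 1))⁻¹) Filter.atTop
      (nhds (-0)) := by
    refine (Filter.Tendsto.inv_tendsto_atTop ?_).neg
    refine Filter.Tendsto.const_mul_atTop (by positivity) ?_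
    exact (Filter.tendsto_pow_atTop (by omega)).comp
      (Filter.tendsto_atTop_add_const_left _ 1 Filter.tendsto_id)
  have hnn : ∀ t ∈ Set.Ioi (0 : ℝ), 0 ≤ ((1 + t) ^ (m + 2))⁻¹ := fun t ht => by
    have := Set.mem_Ioi.mp ht; positivity
  have hi := integrableOn_Ioi_deriv_of_nonneg hc hd hnn hlim
  have hv := integral_Ioi_of_hasDerivAt_of_nonneg hc hd hnn hlim
  rw [← ofReal_integral_eq_lintegral_ofReal hi
    ((ae_restrict_mem measurableSet_Ioi).mono fun t ht => hnn t ht), hv]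
  simp

/-- Tonelli exchanges the expectation with the integral representation of the inverse, leaving the
integral of `(1 + t)` to the power `-E.card`. At least two terms make it converge, hence the `m +
2`. -/
lemma lintegral_inv_sum_norm_sq_stdComplexGaussianVec {ι : Type*} [Fintype ι] (E : Finset ι)
    {m : ℕ} (hE : E.card = m + 2) :
    ∫⁻ y, (ENNReal.ofReal (∑ i ∈ E, ‖y i‖ ^ 2))⁻¹ ∂(stdComplexGaussianVec ι)
      = ENNReal.ofReal (1 / (m + 1)) := by
  simp_rw [fun y : ι → ℂ => inv_ofReal_eq_lintegral_exp
    (Finset.sum_nonneg fun i (_ : i ∈ E) => sq_nonneg ‖y i‖)]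
  rw [lintegral_lintegral_swap (by fun_prop), ← lintegral_Ioi_inv_one_add_pow m]
  refine setLIntegral_congr_fun measurableSet_Ioi fun t ht => ?_
  rw [← hE]
  exact lintegral_exp_neg_sum_norm_sq_stdComplexGaussianVec E (Set.mem_Ioi.mp ht).le

-- Linear algebra of the orthogonal projection and of the zero-forcing vector.

section Projection

variable {m ι : Type*} [Fintype m] [Fintype ι] [DecidableEq ι]

/-- Matrix whose columns are the vectors `H i`. -/
def colMatrix {n κ : Type*} (H : κ → n → ℂ) : Matrix n κ ℂ := Matrix.of fun a i => H i a

lemma colMatrix_mulVec {n κ : Type*} [Fintype κ] (H : κ → n → ℂ) (c : κ → ℂ) :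
    colMatrix H *ᵥ c = ∑ i, c i • H i := by
  ext a
  simp [colMatrix, mulVec, dotProduct, mul_comm]

open scoped ComplexOrder in
lemma isUnit_gram {H : ι → m → ℂ} (hH : LinearIndependent ℂ H) :
    IsUnit ((colMatrix H)ᴴ * colMatrix H) := by
  refine (PosDef.conjTranspose_mul_self _ ?_).isUnit
  rw [mulVec_injective_iff]
  exact hH

variable [DecidableEq m]

/-- Projection onto the orthogonal complement of the vectors `H i`. -/
def orthProj (H : ι → m → ℂ) : Matrix m m ℂ :=
  1 - colMatrix H * ((colMatrix H)ᴴ * colMatrix H)⁻¹ * (colMatrix H)ᴴ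

lemma orthProj_isHermitian (H : ι → m → ℂ) : (orthProj H).IsHermitian := by
  have hG : ((colMatrix H)ᴴ * colMatrix H).IsHermitian := isHermitian_conjTranspose_mul_self _
  refine isHermitian_one.sub ?_
  rw [IsHermitian, conjTranspose_mul, conjTranspose_mul, conjTranspose_conjTranspose, hG.inv.eq,
    Matrix.mul_assoc]

lemma conjTranspose_colMatrix_mul_orthProj {H : ι → m → ℂ} (hH : LinearIndependent ℂ H) :
    (colMatrix H)ᴴ * orthProj H = 0 := by
  have hu := (isUnit_iff_isUnit_det _).mp (isUnit_gram hH)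
  rw [orthProj, Matrix.mul_sub, Matrix.mul_one, ← Matrix.mul_assoc, ← Matrix.mul_assoc,
    mul_nonsing_inv _ hu, Matrix.one_mul, sub_self]

lemma orthProj_mul_self {H : ι → m → ℂ} (hH : LinearIndependent ℂ H) :
    orthProj H * orthProj H = orthProj H := by
  conv_lhs => enter [1]; rw [orthProj]
  rw [Matrix.sub_mul, Matrix.one_mul, Matrix.mul_assoc _ _ (orthProj H),
    conjTranspose_colMatrix_mul_orthProj hH, Matrix.mul_zero, sub_zero]

/-- By cyclicity the subtracted term has the trace of the identity on `ι`. This number is the rank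
that enters the moment formulas. -/
lemma trace_orthProj {H : ι → m → ℂ} (hH : LinearIndependent ℂ H) :
    (orthProj H).trace = (Fintype.card m : ℂ) - Fintype.card ι := by
  have hu := (isUnit_iff_isUnit_det _).mp (isUnit_gram hH)
  rw [orthProj, trace_sub, trace_one, Matrix.mul_assoc, trace_mul_comm, Matrix.mul_assoc,
    nonsing_inv_mul _ hu, trace_one]

lemma orthProj_mulVec_apply {H : ι → m → ℂ} (hH : LinearIndependent ℂ H) (i : ι) :
    orthProj H *ᵥ H i = 0 := by
  have h := congrArg conjTranspose (conjTranspose_colMatrix_mul_orthProj hH)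
  rw [conjTranspose_mul, conjTranspose_conjTranspose, (orthProj_isHermitian H).eq,
    conjTranspose_zero] at h
  ext a
  exact congrFun (congrFun h a) i

lemma star_dotProduct_orthProj_mulVec {H : ι → m → ℂ} (hH : LinearIndependent ℂ H) (i : ι)
    (x : m → ℂ) : star (H i) ⬝ᵥ orthProj H *ᵥ x = 0 := by
  have h : star (orthProj H *ᵥ H i) = 0 := by rw [orthProj_mulVec_apply hH, star_zero]
  rw [star_mulVec, (orthProj_isHermitian H).eq] at h
  rw [dotProduct_mulVec, h, zero_dotProduct]

lemma orthProj_mulVec_eq_zero_of_mem_span {H : ι → m → ℂ} (hH : LinearIndependent ℂ H)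
    {x : m → ℂ} (hx : x ∈ Submodule.span ℂ (Set.range H)) : orthProj H *ᵥ x = 0 := by
  obtain ⟨c, rfl⟩ := (Submodule.mem_span_range_iff_exists_fun ℂ).mp hx
  rw [mulVec_sum]
  simp [mulVec_smul, orthProj_mulVec_apply hH]

lemma sub_orthProj_mulVec_mem_span (H : ι → m → ℂ) (x : m → ℂ) :
    x - orthProj H *ᵥ x ∈ Submodule.span ℂ (Set.range H) := by
  rw [orthProj, sub_mulVec, one_mulVec, sub_sub_cancel, Matrix.mul_assoc, ← mulVec_mulVec,
    colMatrix_mulVec]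
  exact Submodule.sum_mem _ fun i _ => Submodule.smul_mem _ _ (Submodule.subset_span ⟨i, rfl⟩)

lemma ofReal_quadForm {n : Type*} [Fintype n] {B : Matrix n n ℂ} (hB : B.IsHermitian) (x : n → ℂ) :
    (quadForm B x : ℂ) = star x ⬝ᵥ B *ᵥ x := by
  have : star (star x ⬝ᵥ B *ᵥ x) = star x ⬝ᵥ B *ᵥ x := by
    rw [← star_dotProduct_star, star_star, star_mulVec, hB.eq, dotProduct_mulVec]
  exact Complex.conj_eq_iff_re.mp this

lemma sum_norm_sq_eq_star_dotProduct {n : Type*} [Fintype n] (x : n → ℂ) :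
    ((∑ a, ‖x a‖ ^ 2 : ℝ) : ℂ) = star x ⬝ᵥ x := by
  simp [dotProduct, Complex.conj_mul']

lemma sum_norm_sq_mulVec {n : Type*} [Fintype n] {B : Matrix n n ℂ} (hB : B.IsHermitian) (hB2 : B * B = B)
    (x : n → ℂ) :
    ∑ a, ‖(B *ᵥ x) a‖ ^ 2 = quadForm B x := by
  rw [← Complex.ofReal_inj, sum_norm_sq_eq_star_dotProduct, ofReal_quadForm hB, star_mulVec, hB.eq,
    ← dotProduct_mulVec, mulVec_mulVec, hB2]

lemma quadForm_orthProj_nonneg {H : ι → m → ℂ} (hH : LinearIndependent ℂ H) (x : m → ℂ) :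
    0 ≤ quadForm (orthProj H) x := by
  rw [← sum_norm_sq_mulVec (orthProj_isHermitian H) (orthProj_mul_self hH)]
  positivity

/-- Zero-forcing vector for `k`: the column belonging to `k` of the pseudo-inverse. -/
lemma colMatrix_mul_gram_inv_mulVec_single {κ : Type*} [DecidableEq κ] {H : κ → m → ℂ}
    {S : Finset κ} (hH : LinearIndepOn ℂ H (S : Set κ)) {k : κ} (hk : k ∈ S) :
    quadForm (orthProj fun i : S.erase k => H i) (H k) ≠ 0 ∧
    ∑ a, ‖((colMatrix (fun i : S => H i) *
      ((colMatrix fun i : S => H i)ᴴ * colMatrix fun i : S => H i)⁻¹) *ᵥ Pi.single ⟨k, hk⟩ 1) a‖ ^ 2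
        = (quadForm (orthProj fun i : S.erase k => H i) (H k))⁻¹ := by
  have hS : LinearIndependent ℂ fun i : S => H i := hH
  have hT : LinearIndependent ℂ fun i : S.erase k => H i :=
    hH.mono (by exact_mod_cast S.erase_subset k)
  set A := colMatrix fun i : S => H i with hA
  set B := orthProj fun i : S.erase k => H i with hB
  set q := quadForm B (H k) with hq
  have hBh : B.IsHermitian := orthProj_isHermitian _
  have hB2 : B * B = B := orthProj_mul_self hT
  have hu := (isUnit_iff_isUnit_det _).mp (isUnit_gram hS)
  set u := (A * (Aᴴ * A)⁻¹) *ᵥ Pi.single ⟨k, hk⟩ 1 with hudef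
  have hsum : ∑ a, ‖(B *ᵥ H k) a‖ ^ 2 = q := sum_norm_sq_mulVec hBh hB2 _
  -- The projection of `H k` off the other strong estimates still lies in the span of all strong
  -- estimates and is orthogonal to all of them but `H k`. These two properties identify it with `q
  -- • u`.
  have hmem : B *ᵥ H k ∈ Submodule.span ℂ (Set.range fun i : S => H i) := by
    have h1 := sub_orthProj_mulVec_mem_span (fun i : S.erase k => H i) (H k)
    have h2 : Submodule.span ℂ (Set.range fun i : S.erase k => H i)
        ≤ Submodule.span ℂ (Set.range fun i : S => H i) := by
      refine Submodule.span_mono ?_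
      rintro _ ⟨i, rfl⟩
      exact ⟨⟨i, Finset.mem_of_mem_erase i.2⟩, rfl⟩
    have h3 : H k ∈ Submodule.span ℂ (Set.range fun i : S => H i) :=
      Submodule.subset_span ⟨⟨k, hk⟩, rfl⟩
    have h4 := Submodule.sub_mem _ h3 (h2 h1)
    rwa [sub_sub_cancel] at h4
  obtain ⟨c, hc⟩ := (Submodule.mem_span_range_iff_exists_fun ℂ).mp hmem
  rw [← colMatrix_mulVec (fun i : S => H i)] at hc
  have hAp : Aᴴ *ᵥ (B *ᵥ H k) = (q : ℂ) • Pi.single ⟨k, hk⟩ 1 := by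
    ext i
    change star (H i) ⬝ᵥ B *ᵥ H k = _
    by_cases hi : (i : κ) = k
    · have : i = ⟨k, hk⟩ := Subtype.ext hi
      subst this
      rw [← ofReal_quadForm hBh]
      simp [hq]
    · have h0 := star_dotProduct_orthProj_mulVec hT ⟨i, Finset.mem_erase.mpr ⟨hi, i.2⟩⟩ (H k)
      have hne : i ≠ ⟨k, hk⟩ := fun h => hi (congrArg Subtype.val h)
      simp only [Pi.smul_apply, Pi.single_eq_of_ne hne, smul_zero]
      exact h0
  have hpu : B *ᵥ H k = (q : ℂ) • u := by
    have h1 : Aᴴ *ᵥ (A *ᵥ c) = (q : ℂ) • Pi.single ⟨k, hk⟩ 1 := by rw [hA, hc, ← hA, hAp]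
    rw [mulVec_mulVec] at h1
    have h2 : c = (q : ℂ) • ((Aᴴ * A)⁻¹ *ᵥ Pi.single ⟨k, hk⟩ 1) := by
      rw [← mulVec_smul, ← h1, mulVec_mulVec, nonsing_inv_mul _ hu, one_mulVec]
    rw [← hc, h2, mulVec_smul, mulVec_mulVec]
  -- If `q` vanished, `H k` would lie in the span of the other vectors, against linear independence.
  have hq0 : q ≠ 0 := by
    intro h0
    have hz : B *ᵥ H k = 0 := by rw [hpu, h0]; simp
    have h1 := sub_orthProj_mulVec_mem_span (fun i : S.erase k => H i) (H k)
    rw [← hB, hz, sub_zero] at h1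
    have h2 := hS.notMem_span_image (s := {i : S | (i : κ) ≠ k}) (x := ⟨k, hk⟩) (by simp)
    refine h2 (Submodule.span_mono ?_ h1)
    rintro _ ⟨i, rfl⟩
    exact ⟨⟨i, Finset.mem_of_mem_erase i.2⟩, Finset.ne_of_mem_erase i.2, rfl⟩
  refine ⟨hq0, ?_⟩
  -- Since `B *ᵥ H k` equals `q • u` and has squared norm `q`, the squared norm of `u` is `1 / q`.
  have h1 : q = q ^ 2 * ∑ a, ‖u a‖ ^ 2 := by
    conv_lhs => rw [← hsum, hpu]
    rw [Finset.mul_sum]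
    refine Finset.sum_congr rfl fun a _ => ?_
    simp [mul_pow]
  field_simp
  have h2 : q * 1 = q * (q * ∑ a, ‖u a‖ ^ 2) := by linarith
  have := mul_left_cancel₀ hq0 h2
  linarith

end Projection

-- Joint law of the channel estimates and the estimation error.

section Law

variable {L K M τ : ℕ} {Ω : Type*} [MeasurableSpace Ω] {μ : Measure Ω}

/-- An independent `CN(0, 1)` family indexed by pairs, regrouped into independent vectors. -/
lemma iIndepFun_curry_stdComplexGaussian [IsProbabilityMeasure μ] {ι κ : Type*} [Fintype ι]
    [Fintype κ] {Z : ι → Ω → κ → ℂ} (hZm : ∀ i, Measurable (Z i))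
    (hZ : μ.map (fun ω (p : ι × κ) => Z p.1 ω p.2) = stdComplexGaussianVec (ι × κ)) :
    iIndepFun Z μ ∧ ∀ i, μ.map (Z i) = stdComplexGaussianVec κ := by
  have hjoint : μ.map (fun ω i => Z i ω) = Measure.pi fun _ : ι => stdComplexGaussianVec κ := by
    have h1 : (fun ω i => Z i ω)
        = (MeasurableEquiv.curry ι κ ℂ) ∘ fun ω (p : ι × κ) => Z p.1 ω p.2 := rfl
    rw [h1, ← Measure.map_map (MeasurableEquiv.measurable _) (by fun_prop), hZ,
      stdComplexGaussianVec, ← Measure.infinitePi_eq_pi,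
      Measure.infinitePi_map_curry (fun _ _ => stdComplexGaussian), Measure.infinitePi_eq_pi]
    simp_rw [Measure.infinitePi_eq_pi]
  have hlaw : ∀ i, μ.map (Z i) = stdComplexGaussianVec κ := fun i => by
    have h1 : Z i = (fun z : ι → κ → ℂ => z i) ∘ fun ω i => Z i ω := rfl
    rw [h1, ← Measure.map_map (by fun_prop) (by fun_prop), hjoint]
    exact (measurePreserving_eval (fun _ : ι => stdComplexGaussianVec κ) i).map_eq
  refine ⟨?_, hlaw⟩
  rw [iIndepFun_iff_map_fun_eq_pi_map (fun i => (hZm i).aemeasurable), hjoint]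
  simp_rw [hlaw]

namespace Params

/-- Coefficients of the signal in the pilot direction of user `j` at AP `l` in terms of the users'
fading, the eavesdropper's fading and the training noise at one antenna. -/
def pilotRow [NeZero K] (P : Params L K M τ) (l : Fin L) (j : Fin K) :
    Fin K ⊕ Unit ⊕ Fin τ → ℂ
  | .inl i => if i = j then (√(τ * P.ρu) : ℂ) * (√(P.β l j) : ℂ) else 0
  | .inr (.inl _) => if j = 0 then (√(τ * P.ρE) : ℂ) * (√(P.βE l) : ℂ) else 0
  | .inr (.inr i) => P.φ j i

variable [NeZero K] (P : Params L K M τ)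

lemma pilotVar_pos (hβ : ∀ l k, 0 < P.β l k) (hβE : ∀ l, 0 ≤ P.βE l)
    (hρu : 0 < P.ρu) (hρE : 0 ≤ P.ρE) (l : Fin L) (k : Fin K) : 0 < P.pilotVar l k := by
  have := hβ l k
  have := hβE l
  unfold pilotVar
  split_ifs <;> positivity

lemma γ_pos (hβ : ∀ l k, 0 < P.β l k) (hβE : ∀ l, 0 ≤ P.βE l)
    (hρu : 0 < P.ρu) (hρE : 0 ≤ P.ρE) (hτ : 0 < τ) (l : Fin L) (k : Fin K) : 0 < P.γ l k := by
  have := hβ l k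
  have := P.pilotVar_pos hβ hβE hρu hρE l k
  have : (0 : ℝ) < τ := by exact_mod_cast hτ
  unfold γ
  positivity

/-- The unit noise variance in `pilotVar` makes the inequality strict. Strictness matters because
the error is normalized by `√(β - γ)`. -/
lemma γ_lt_β (hβ : ∀ l k, 0 < P.β l k) (hβE : ∀ l, 0 ≤ P.βE l)
    (hρu : 0 < P.ρu) (hρE : 0 ≤ P.ρE) (l : Fin L) (k : Fin K) : P.γ l k < P.β l k := by
  have hb := hβ l k
  have hv := P.pilotVar_pos hβ hβE hρu hρE l k
  rw [γ, div_lt_iff₀ hv]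
  have h : τ * P.ρu * P.β l k < P.pilotVar l k := by
    have := hβE l
    unfold pilotVar
    split_ifs
    · have : 0 ≤ τ * P.ρE * P.βE l := by positivity
      linarith
    · linarith
  nlinarith

/-- There is at least one user, whose pilot is a nonzero vector. -/
lemma tau_pos_of_orthonormal (hφ : Orthonormal ℂ P.φ) : 0 < τ := by
  rcases Nat.eq_zero_or_pos τ with rfl | h
  · exact absurd (Subsingleton.elim _ _) (hφ.ne_zero 0)
  · exact h

/-- Rows of distinct users have disjoint supports in the user block, at most one of them involves
the eavesdropper, and the noise blocks are the orthonormal pilots. -/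
lemma pilotRow_dotProduct (hβ : ∀ l k, 0 < P.β l k) (hβE : ∀ l, 0 ≤ P.βE l)
    (hρu : 0 < P.ρu) (hρE : 0 ≤ P.ρE) (hφ : Orthonormal ℂ P.φ) (l : Fin L) (j j' : Fin K) :
    P.pilotRow l j ⬝ᵥ star (P.pilotRow l j') = if j = j' then (P.pilotVar l j : ℂ) else 0 := by
  have hb := hβ l j
  have hbE := hβE l
  have horth : ∑ i, P.φ j i * star (P.φ j' i) = if j = j' then 1 else 0 := by
    have h := (orthonormal_iff_ite.mp hφ) j' j
    simp only [PiLp.inner_apply, RCLike.inner_apply] at h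
    simp only [Complex.star_def]
    rw [h]
    simp [eq_comm]
  rw [dotProduct, Fintype.sum_sum_type, Fintype.sum_sum_type]
  simp only [pilotRow, Pi.star_apply, horth]
  by_cases hjj : j = j'
  · subst hjj
    have e1 : ((√(τ * P.ρu) : ℂ) * (√(P.β l j) : ℂ)) * star ((√(τ * P.ρu) : ℂ) * (√(P.β l j) : ℂ))
        = ((τ * P.ρu * P.β l j : ℝ) : ℂ) := by
      rw [star_mul', Complex.star_def, Complex.conj_ofReal, Complex.conj_ofReal]
      rw [mul_mul_mul_comm, ← Complex.ofReal_mul, ← Complex.ofReal_mul, ← Complex.ofReal_mul,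
        Real.mul_self_sqrt (by positivity), Real.mul_self_sqrt hb.le]
    have e2 : ((√(τ * P.ρE) : ℂ) * (√(P.βE l) : ℂ)) * star ((√(τ * P.ρE) : ℂ) * (√(P.βE l) : ℂ))
        = ((τ * P.ρE * P.βE l : ℝ) : ℂ) := by
      rw [star_mul', Complex.star_def, Complex.conj_ofReal, Complex.conj_ofReal]
      rw [mul_mul_mul_comm, ← Complex.ofReal_mul, ← Complex.ofReal_mul, ← Complex.ofReal_mul,
        Real.mul_self_sqrt (by positivity), Real.mul_self_sqrt hbE]
    have s1 : ∑ x, (if x = j then (√(τ * P.ρu) : ℂ) * (√(P.β l j) : ℂ) else 0)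
        * star (if x = j then (√(τ * P.ρu) : ℂ) * (√(P.β l j) : ℂ) else 0)
        = ((τ * P.ρu * P.β l j : ℝ) : ℂ) := by
      rw [Finset.sum_eq_single j (fun b _ hb => by simp [hb]) (by simp)]
      simpa using e1
    rw [s1]
    simp only [Finset.univ_unique, Finset.sum_const, Finset.card_singleton, one_smul, if_true,
      pilotVar]
    by_cases h0 : j = 0
    · simp only [h0, if_true] at e2 ⊢
      rw [e2]
      push_cast
      ring
    · simp only [h0, if_false]
      push_cast
      simp
  · have s1 : ∑ x, (if x = j then (√(τ * P.ρu) : ℂ) * (√(P.β l j) : ℂ) else 0)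
        * star (if x = j' then (√(τ * P.ρu) : ℂ) * (√(P.β l j') : ℂ) else 0) = 0 := by
      refine Finset.sum_eq_zero fun x _ => ?_
      by_cases hx : x = j
      · have : x ≠ j' := fun h => hjj (hx.symm.trans h)
        simp [this]
      · simp [hx]
    rw [s1]
    simp only [Finset.univ_unique, Finset.sum_const, Finset.card_singleton, one_smul, hjj, if_false]
    by_cases h0 : j = 0
    · have : j' ≠ 0 := fun h => hjj (h0.trans h.symm)
      simp [this]
    · simp [h0]

/-- Rows of the normalized estimates (indexed by `some j`) and of the normalized estimation error
of user `k` (indexed by `none`). -/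
def normRow (l : Fin L) (k : Fin K) : Option (Fin K) → Fin K ⊕ Unit ⊕ Fin τ → ℂ
  | some j => ((1 / √(P.pilotVar l j) : ℝ) : ℂ) • P.pilotRow l j
  | none => ((1 / √(P.β l k - P.γ l k) : ℝ) : ℂ) •
      (((√(P.β l k) : ℝ) : ℂ) • Pi.single (.inl k) 1
        - ((√(P.γ l k) / √(P.pilotVar l k) : ℝ) : ℂ) • P.pilotRow l k)

/-- This is the orthogonality principle of MMSE estimation: the error is uncorrelated with every
pilot observation, and its variance is `β - 2γ + γ = β - γ`. For Gaussian vectors orthonormal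
coefficient rows give independence. -/
lemma normRow_dotProduct (hβ : ∀ l k, 0 < P.β l k) (hβE : ∀ l, 0 ≤ P.βE l)
    (hρu : 0 < P.ρu) (hρE : 0 ≤ P.ρE) (hφ : Orthonormal ℂ P.φ) (l : Fin L) (k : Fin K)
    (o o' : Option (Fin K)) :
    P.normRow l k o ⬝ᵥ star (P.normRow l k o') = if o = o' then 1 else 0 := by
  have hτ : (0 : ℝ) < τ := by exact_mod_cast P.tau_pos_of_orthonormal hφ
  have hv := fun j => P.pilotVar_pos hβ hβE hρu hρE l j
  have hγ := fun j => P.γ_pos hβ hβE hρu hρE (P.tau_pos_of_orthonormal hφ) l j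
  have hb := hβ l k
  have hlt := P.γ_lt_β hβ hβE hρu hρE l k
  have hyy := P.pilotRow_dotProduct hβ hβE hρu hρE hφ l
  have hsingle : (Pi.single (.inl k) 1 : Fin K ⊕ Unit ⊕ Fin τ → ℂ) ⬝ᵥ
      star (Pi.single (.inl k) 1) = 1 := by simp [Pi.star_single]
  -- Both sides are the covariance of the channel with the observation; all cancellations below come
  -- from this identity.
  have hgy : √(P.γ l k) * √(P.pilotVar l k) = √(τ * P.ρu) * P.β l k := by
    rw [← Real.sqrt_mul (hγ k).le, γ, div_mul_cancel₀ _ (hv k).ne',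
      Real.sqrt_mul (by positivity), Real.sqrt_sq hb.le]
  have hey : ∀ j, (Pi.single (.inl k) 1 : Fin K ⊕ Unit ⊕ Fin τ → ℂ) ⬝ᵥ star (P.pilotRow l j)
      = if k = j then ((√(τ * P.ρu) * √(P.β l j) : ℝ) : ℂ) else 0 := by
    intro j
    rw [single_dotProduct, one_mul, Pi.star_apply, pilotRow]
    split_ifs <;> simp
  have hye : ∀ j, P.pilotRow l j ⬝ᵥ star (Pi.single (.inl k) 1 : Fin K ⊕ Unit ⊕ Fin τ → ℂ)
      = if k = j then ((√(τ * P.ρu) * √(P.β l j) : ℝ) : ℂ) else 0 := by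
    intro j
    rw [Pi.star_single, star_one, dotProduct_single, mul_one, pilotRow]
    split_ifs <;> simp
  have hsv : √(P.pilotVar l k) ^ 2 = P.pilotVar l k := Real.sq_sqrt (hv k).le
  have hsv0 : √(P.pilotVar l k) ≠ 0 := (Real.sqrt_pos.mpr (hv k)).ne'
  have hsb : √(P.β l k) ^ 2 = P.β l k := Real.sq_sqrt hb.le
  have hsg : √(P.γ l k) ^ 2 = P.γ l k := Real.sq_sqrt (hγ k).le
  have hd : √(P.β l k - P.γ l k) ^ 2 = P.β l k - P.γ l k := Real.sq_sqrt (by linarith)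
  have hd0 : √(P.β l k - P.γ l k) ≠ 0 := (Real.sqrt_pos.mpr (by linarith)).ne'
  have hbg : √(P.β l k) * (√(τ * P.ρu) * √(P.β l k)) = √(P.γ l k) * √(P.pilotVar l k) := by
    rw [hgy]; linear_combination √(τ * P.ρu) * hsb
  have hbg' : √(P.β l k) * (1 / √(P.pilotVar l k) * (√(τ * P.ρu) * √(P.β l k))) = √(P.γ l k) := by
    rw [mul_left_comm, hbg]; field_simp
  have hgg : √(P.γ l k) / √(P.pilotVar l k) * (1 / √(P.pilotVar l k) * P.pilotVar l k)
      = √(P.γ l k) := by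
    nth_rw 3 [← hsv]; field_simp
  have hgg2 : √(P.γ l k) / √(P.pilotVar l k) * P.pilotVar l k = √(P.γ l k) * √(P.pilotVar l k) := by
    nth_rw 2 [← hsv]; field_simp
  rcases o with _ | j <;> rcases o' with _ | j'
  · simp only [normRow, star_smul, star_sub, smul_dotProduct, dotProduct_smul, sub_dotProduct,
      dotProduct_sub, hsingle, hey, hye, hyy, if_true, smul_eq_mul, Complex.star_def,
      Complex.conj_ofReal]
    norm_cast
    have : 1 / √(P.β l k - P.γ l k) ^ 2 * (√(P.β l k) ^ 2
        - 2 * (√(P.γ l k) / √(P.pilotVar l k) * (√(P.β l k) * (√(τ * P.ρu) * √(P.β l k))))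
        + √(P.γ l k) ^ 2 / √(P.pilotVar l k) ^ 2 * P.pilotVar l k) = 1 := by
      rw [hbg, hsv, hsb, hd]
      have h1 : P.β l k - P.γ l k ≠ 0 := by linarith
      have h2 := (hv k).ne'
      field_simp
      linear_combination (-1 : ℝ) * hsg
    refine Eq.trans ?_ this
    ring
  · simp only [normRow, star_smul, smul_dotProduct, dotProduct_smul, sub_dotProduct, hey, hyy,
      smul_eq_mul, Complex.star_def, Complex.conj_ofReal]
    by_cases h : k = j'
    · subst h
      simp only [if_true, reduceCtorEq, if_false]
      norm_cast
      rw [hbg, hgg2, sub_self, mul_zero, mul_zero]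
    · simp [h]
  · simp only [normRow, star_smul, star_sub, smul_dotProduct, dotProduct_smul,
      dotProduct_sub, hye, hyy, smul_eq_mul, Complex.star_def, Complex.conj_ofReal]
    by_cases h : k = j
    · subst h
      simp only [if_true, reduceCtorEq, if_false]
      norm_cast
      rw [hbg', hgg, sub_self, mul_zero]
    · simp [h, Ne.symm h, eq_comm]
  · simp only [normRow, star_smul, smul_dotProduct, dotProduct_smul, hyy, smul_eq_mul,
      Complex.star_def, Complex.conj_ofReal, Option.some.injEq]
    split_ifs with h
    · subst h
      have h1 := Real.sq_sqrt (hv j).le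
      have h2 := (Real.sqrt_pos.mpr (hv j)).ne'
      norm_cast
      field_simp
      linarith
    · simp

/-- The sources of randomness at AP `l`. -/
def sourceIndex (l : Fin L) : (Fin K ⊕ Unit ⊕ Fin τ) × Fin M →
    (Fin L × Fin K × Fin M) ⊕ (Fin L × Fin M) ⊕ (Fin L × Fin M × Fin τ)
  | (.inl k, m) => .inl (l, k, m)
  | (.inr (.inl _), m) => .inr (.inl (l, m))
  | (.inr (.inr i), m) => .inr (.inr (l, m, i))

end Params

lemma Params.sourceIndex_injective (l : Fin L) :
    Function.Injective (Params.sourceIndex (K := K) (M := M) (τ := τ) l) := by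
  rintro ⟨_ | _ | _, m⟩ ⟨_ | _ | _, m'⟩ h <;> simp_all [Params.sourceIndex]

lemma Block.IsRayleigh.map_source {X : Block L K M τ Ω} [IsProbabilityMeasure μ]
    (hX : X.IsRayleigh μ) (l : Fin L) :
    μ.map (fun ω p => X.family (Params.sourceIndex l p) ω) = stdComplexGaussianVec _ := by
  have h := hX.indep.precomp (Params.sourceIndex_injective l)
  rw [iIndepFun_iff_map_fun_eq_pi_map (fun i => (hX.measurable _).aemeasurable)] at h
  rw [h]
  simp_rw [hX.law]

/-- The channel estimates at AP `l` are scaled independent standard complex Gaussian vectors,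
and the estimation error of user `k` is one more such vector. -/
lemma Params.exists_gaussian_representation [NeZero K] (P : Params L K M τ)
    {X : Block L K M τ Ω} [IsProbabilityMeasure μ]
    (hβ : ∀ l k, 0 < P.β l k) (hβE : ∀ l, 0 ≤ P.βE l)
    (hρu : 0 < P.ρu) (hρE : 0 ≤ P.ρE) (hφ : Orthonormal ℂ P.φ)
    (hX : X.IsRayleigh μ) (l : Fin L) (k : Fin K) :
    ∃ Z : Option (Fin K) → Ω → Fin M → ℂ, (∀ o, Measurable (Z o)) ∧ iIndepFun Z μ ∧
      (∀ o, μ.map (Z o) = stdComplexGaussianVec (Fin M)) ∧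
      (∀ j ω, P.hhat X l j ω = (√(P.γ l j) : ℂ) • Z (some j) ω) ∧
      (∀ ω, P.h X l k ω = P.hhat X l k ω + (√(P.β l k - P.γ l k) : ℂ) • Z none ω) := by
  classical
  set G : Ω → (Fin K ⊕ Unit ⊕ Fin τ) × Fin M → ℂ :=
    fun ω p => X.family (Params.sourceIndex l p) ω with hG
  set C : Matrix (Option (Fin K)) (Fin K ⊕ Unit ⊕ Fin τ) ℂ := Matrix.of (P.normRow l k) with hC
  have hCC : C * Cᴴ = 1 := by
    ext o o'
    rw [Matrix.one_apply, ← P.normRow_dotProduct hβ hβE hρu hρE hφ l k o o']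
    rfl
  -- The same combination of sources is formed at each antenna, so the joint transformation is a
  -- Kronecker product with the identity.
  set V := kroneckerMap (· * ·) C (1 : Matrix (Fin M) (Fin M) ℂ) with hV
  have hVV : V * Vᴴ = 1 := by
    rw [hV, conjTranspose_kronecker, ← mul_kronecker_mul, hCC, conjTranspose_one, Matrix.one_mul,
      one_kronecker_one]
  have hGm : Measurable G := measurable_pi_lambda _ fun p => hX.measurable _
  set Z : Option (Fin K) → Ω → Fin M → ℂ := fun o ω m => ∑ s, C o s * G ω (s, m) with hZ
  have hZV : (fun ω (p : Option (Fin K) × Fin M) => Z p.1 ω p.2) = (fun x => V *ᵥ x) ∘ G := by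
    funext ω p
    simp only [hZ, hV, Function.comp_apply, mulVec, dotProduct, kroneckerMap_apply,
      Fintype.sum_prod_type]
    refine Finset.sum_congr rfl fun s _ => ?_
    simp [Matrix.one_apply]
  have hZm : ∀ o, Measurable (Z o) := fun o => by
    refine measurable_pi_lambda _ fun m => ?_
    fun_prop
  have hZlaw : μ.map (fun ω (p : Option (Fin K) × Fin M) => Z p.1 ω p.2)
      = stdComplexGaussianVec _ := by
    rw [hZV, ← Measure.map_map (by fun_prop) hGm, hX.map_source l, stdComplexGaussianVec,
      map_mulVec_pi_stdComplexGaussian V hVV]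
  obtain ⟨hi, hl⟩ := iIndepFun_curry_stdComplexGaussian hZm hZlaw
  have hv := fun j => P.pilotVar_pos hβ hβE hρu hρE l j
  have hγ := fun j => P.γ_pos hβ hβE hρu hρE (P.tau_pos_of_orthonormal hφ) l j
  have hb := hβ l k
  have hlt := P.γ_lt_β hβ hβE hρu hρE l k
  -- Correlating with the pilot of `j` removes every other user, and removes the eavesdropper unless
  -- `j = 0`.
  have hY : ∀ j ω m, (P.Y X l ω *ᵥ (P.φ j).ofLp) m = ∑ s, P.pilotRow l j s * G ω (s, m) := by
    intro j ω m
    have horth : ∀ i, star (P.φ i).ofLp ⬝ᵥ (P.φ j).ofLp = if i = j then 1 else 0 := fun i => by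
      have h := (orthonormal_iff_ite.mp hφ) i j
      simp only [PiLp.inner_apply, RCLike.inner_apply] at h
      rw [← h, dotProduct]
      exact Finset.sum_congr rfl fun _ _ => mul_comm _ _
    rw [Params.Y, add_mulVec, add_mulVec, smul_mulVec, smul_mulVec, sum_mulVec]
    simp only [vecMulVec_mulVec, horth, Pi.add_apply, Pi.smul_apply, Finset.sum_apply]
    rw [Fintype.sum_sum_type, Fintype.sum_sum_type]
    simp only [Params.pilotRow, Finset.univ_unique, Finset.sum_singleton, hG, Params.sourceIndex,
      Block.family, ite_mul, zero_mul, Finset.sum_ite_eq', Finset.mem_univ, if_true]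
    have hsum : ∑ x, MulOpposite.op (if x = j then (1 : ℂ) else 0) • P.h X l x ω m
        = P.h X l j ω m := by
      rw [Finset.sum_eq_single j (fun b _ hb => by simp [hb]) (by simp)]
      simp
    rw [hsum, add_assoc]
    congr 1
    · simp [Params.h, mul_assoc]
    · congr 1
      · by_cases h0 : j = 0
        · simp [h0, Params.hE, mul_assoc]
        · simp [h0, Ne.symm h0]
      · simp [mulVec, dotProduct, mul_comm]
  have hhat : ∀ j ω, P.hhat X l j ω = (√(P.γ l j) : ℂ) • Z (some j) ω := by
    intro j ω
    have hc : √(τ * P.ρu) * P.β l j / P.pilotVar l j = √(P.γ l j) * (1 / √(P.pilotVar l j)) := by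
      have h1 : 0 ≤ τ * P.ρu := by positivity
      rw [Params.γ, Real.sqrt_div (by positivity), Real.sqrt_mul h1, Real.sqrt_sq (hβ l j).le,
        div_mul_div_comm, mul_one, Real.mul_self_sqrt (hv j).le]
    ext m
    simp only [Params.hhat, Pi.smul_apply, hY, hZ, hC, Matrix.of_apply, Params.normRow, smul_eq_mul,
      hc, Finset.mul_sum]
    refine Finset.sum_congr rfl fun s _ => ?_
    push_cast
    ring
  refine ⟨Z, hZm, hi, hl, hhat, fun ω => ?_⟩
  rw [hhat]
  ext m
  have hnone : Z none ω m = ((1 / √(P.β l k - P.γ l k) : ℝ) : ℂ) *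
      ((√(P.β l k) : ℂ) * X.g l k m ω - (√(P.γ l k) : ℂ) * Z (some k) ω m) := by
    have hg : X.g l k m ω
        = ∑ s, (Pi.single (.inl k) 1 : Fin K ⊕ Unit ⊕ Fin τ → ℂ) s * G ω (s, m) := by
      rw [← dotProduct, single_dotProduct, one_mul]
      rfl
    rw [hg, Finset.mul_sum]
    simp only [hZ, hC, Matrix.of_apply, Params.normRow, Finset.mul_sum, ← Finset.sum_sub_distrib]
    refine Finset.sum_congr rfl fun s _ => ?_
    simp only [Pi.smul_apply, Pi.sub_apply, smul_eq_mul]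
    push_cast
    ring
  have hd0 : (√(P.β l k - P.γ l k) : ℂ) ≠ 0 := by
    exact_mod_cast (Real.sqrt_pos.mpr (by linarith)).ne'
  simp only [Pi.add_apply, Pi.smul_apply, smul_eq_mul, hnone, Params.h]
  push_cast
  field_simp
  ring

end Law

-- The precoder as a measurable function of the estimates.

section Precoder

variable {m ι κ : Type*} [Fintype m] [Fintype ι] [DecidableEq ι]

/-- By the adjugate formula, an entry of the inverse is a continuous function times the inverse of
the determinant. Singular Gram matrices need no separate treatment, since inversion in `ℂ` is
measurable with `0⁻¹ = 0`. -/
lemma measurable_gram_inv_apply (i j : ι) :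
    Measurable fun H : ι → m → ℂ => ((colMatrix H)ᴴ * colMatrix H)⁻¹ i j := by
  have hc : Continuous fun H : ι → m → ℂ => (colMatrix H)ᴴ * colMatrix H := by
    have h1 : Continuous fun H : ι → m → ℂ => colMatrix H := by
      refine continuous_matrix fun a i => ?_
      change Continuous fun H : ι → m → ℂ => H i a
      fun_prop
    exact h1.matrix_conjTranspose.matrix_mul h1
  simp_rw [Matrix.inv_def, Ring.inverse_eq_inv', Matrix.smul_apply, smul_eq_mul]
  exact hc.matrix_det.measurable.inv.mul ((hc.matrix_adjugate.matrix_elem i j).measurable)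

lemma measurable_colMatrix_mul_gram_inv_apply (a : m) (j : ι) :
    Measurable fun H : ι → m → ℂ => (colMatrix H * ((colMatrix H)ᴴ * colMatrix H)⁻¹) a j := by
  simp_rw [Matrix.mul_apply]
  refine Finset.measurable_fun_sum _ fun i _ => ?_
  refine Measurable.mul ?_ (measurable_gram_inv_apply i j)
  change Measurable fun H : ι → m → ℂ => H i a
  fun_prop

variable [DecidableEq m] [DecidableEq κ]

/-- Precoding vector of `k` when the estimates are `H` and the strong users are those in `S`. -/
def precoder (S : Finset κ) (H : κ → m → ℂ) (k : κ) : m → ℂ :=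
  if hk : k ∈ S then
    (colMatrix (fun i : S => H i) *
      ((colMatrix fun i : S => H i)ᴴ * colMatrix fun i : S => H i)⁻¹) *ᵥ Pi.single ⟨k, hk⟩ 1
  else orthProj (fun i : S => H i) *ᵥ H k

lemma measurable_orthProj_apply (a b : m) :
    Measurable fun H : ι → m → ℂ => orthProj H a b := by
  simp_rw [orthProj, Matrix.sub_apply]
  refine measurable_const.sub ?_
  simp_rw [Matrix.mul_apply (N := (colMatrix _)ᴴ)]
  refine Finset.measurable_fun_sum _ fun i _ => ?_
  refine (measurable_colMatrix_mul_gram_inv_apply a i).mul ?_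
  change Measurable fun H : ι → m → ℂ => star (H i b)
  fun_prop

lemma measurable_orthProj_mulVec_apply (a : m) :
    Measurable fun p : (ι → m → ℂ) × (m → ℂ) => (orthProj p.1 *ᵥ p.2) a := by
  simp_rw [mulVec, dotProduct]
  refine Finset.measurable_fun_sum _ fun b _ => ?_
  exact ((measurable_orthProj_apply a b).comp measurable_fst).mul (by fun_prop)

lemma measurable_quadForm_orthProj :
    Measurable fun p : (ι → m → ℂ) × (m → ℂ) => quadForm (orthProj p.1) p.2 := by
  unfold quadForm
  refine Complex.measurable_re.comp (Finset.measurable_fun_sum _ fun b _ => ?_)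
  refine Measurable.mul ?_ (measurable_orthProj_mulVec_apply b)
  change Measurable fun p : (ι → m → ℂ) × (m → ℂ) => star (p.2 b)
  fun_prop

lemma measurable_precoder [Fintype κ] (S : Finset κ) (k : κ) :
    Measurable fun H : κ → m → ℂ => precoder S H k := by
  have hr : Measurable fun (H : κ → m → ℂ) (i : S) => H i := by fun_prop
  refine measurable_pi_lambda _ fun a => ?_
  by_cases hk : k ∈ S
  · have h : (fun H : κ → m → ℂ => precoder S H k a)
        = (fun H : S → m → ℂ => (colMatrix H * ((colMatrix H)ᴴ * colMatrix H)⁻¹) a ⟨k, hk⟩)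
          ∘ fun (H : κ → m → ℂ) (i : S) => H i := by
      funext H
      rw [precoder, dif_pos hk, mulVec_single_one, col_apply]
      rfl
    rw [h]
    have hm := measurable_colMatrix_mul_gram_inv_apply (m := m) (ι := S) a ⟨k, hk⟩
    exact hm.comp hr
  · have h : (fun H : κ → m → ℂ => precoder S H k a)
        = (fun p : (S → m → ℂ) × (m → ℂ) => (orthProj p.1 *ᵥ p.2) a)
          ∘ fun (H : κ → m → ℂ) => (fun (i : S) => H i, H k) := by
      funext H
      rw [precoder, dif_neg hk]
      rfl
    rw [h]
    exact (measurable_orthProj_mulVec_apply a).comp (hr.prodMk (measurable_pi_apply k))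

/-- A precoder reads only the strong estimates and its own. Hence precoders of other users do not
involve the estimate of a weak user. -/
lemma precoder_congr {S : Finset κ} {H H' : κ → m → ℂ} {k : κ} (h : ∀ i ∈ S, H i = H' i)
    (hk : H k = H' k) : precoder S H k = precoder S H' k := by
  have : (fun i : S => H i) = fun i : S => H' i := funext fun i => h i i.2
  unfold precoder
  rw [this, hk]

end Precoder

-- Moments of the projected Gaussian vector, in terms of the codimension.

section ProjectionMoments

variable {ι : Type*} [Fintype ι] [DecidableEq ι] {M : ℕ}

lemma trace_orthProj_eq_natCast {H : ι → Fin M → ℂ} (hH : LinearIndependent ℂ H) {n : ℕ}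
    (hn : Fintype.card ι + n = M) : (orthProj H).trace = n := by
  rw [trace_orthProj hH, Fintype.card_fin]
  have : (M : ℂ) = Fintype.card ι + n := by exact_mod_cast hn.symm
  rw [this]; ring

lemma lintegral_quadForm_orthProj {H : ι → Fin M → ℂ} (hH : LinearIndependent ℂ H) {n : ℕ}
    (hn : Fintype.card ι + n = M) :
    ∫⁻ x, ENNReal.ofReal (quadForm (orthProj H) x) ∂(stdComplexGaussianVec (Fin M)) = n := by
  obtain ⟨E, hE, h⟩ := exists_lintegral_quadForm_projection (orthProj_isHermitian H)
    (orthProj_mul_self hH) (trace_orthProj_eq_natCast hH hn)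
  rw [h _ (by fun_prop), lintegral_sum_norm_sq_stdComplexGaussianVec, hE]

lemma lintegral_quadForm_orthProj_sq {H : ι → Fin M → ℂ} (hH : LinearIndependent ℂ H) {n : ℕ}
    (hn : Fintype.card ι + n = M) :
    ∫⁻ x, ENNReal.ofReal (quadForm (orthProj H) x ^ 2) ∂(stdComplexGaussianVec (Fin M))
      = n * (n + 1) := by
  obtain ⟨E, hE, h⟩ := exists_lintegral_quadForm_projection (orthProj_isHermitian H)
    (orthProj_mul_self hH) (trace_orthProj_eq_natCast hH hn)
  rw [h (fun r => ENNReal.ofReal (r ^ 2)) (by fun_prop),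
    lintegral_sum_norm_sq_sq_stdComplexGaussianVec, hE]

lemma lintegral_inv_quadForm_orthProj {H : ι → Fin M → ℂ} (hH : LinearIndependent ℂ H) {n : ℕ}
    (hn : Fintype.card ι + (n + 2) = M) :
    ∫⁻ x, (ENNReal.ofReal (quadForm (orthProj H) x))⁻¹ ∂(stdComplexGaussianVec (Fin M))
      = ENNReal.ofReal (1 / (n + 1)) := by
  obtain ⟨E, hE, h⟩ := exists_lintegral_quadForm_projection (orthProj_isHermitian H)
    (orthProj_mul_self hH) (trace_orthProj_eq_natCast hH hn)
  rw [h (fun r => (ENNReal.ofReal r)⁻¹) (by fun_prop),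
    lintegral_inv_sum_norm_sq_stdComplexGaussianVec E hE]

end ProjectionMoments

-- Mean power of the precoding vectors.

section GaussianEstimates

variable {κ Ω : Type*} {M : ℕ} [MeasurableSpace Ω] {μ : Measure Ω}

/-- Vectors `H j` that are positive multiples of independent standard complex Gaussian vectors;
`c j ^ 2` is the variance of the entries of `H j`. -/
structure IsGaussianEstimates (H : κ → Ω → Fin M → ℂ) (c : κ → ℝ) (μ : Measure Ω) : Prop where
  pos : ∀ j, 0 < c j
  exists_std : ∃ Z : κ → Ω → Fin M → ℂ, (∀ j, Measurable (Z j)) ∧ iIndepFun Z μ ∧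
    (∀ j, μ.map (Z j) = stdComplexGaussianVec (Fin M)) ∧ ∀ j ω, H j ω = (c j : ℂ) • Z j ω

variable {H : κ → Ω → Fin M → ℂ} {c : κ → ℝ}

lemma IsGaussianEstimates.measurable (hH : IsGaussianEstimates H c μ) (j : κ) :
    Measurable (H j) := by
  obtain ⟨Z, hZ, -, -, h⟩ := hH.exists_std
  rw [show H j = fun ω => (c j : ℂ) • Z j ω from funext (h j)]
  fun_prop

lemma IsGaussianEstimates.measurable_quadForm (hH : IsGaussianEstimates H c μ) [DecidableEq κ]
    (T : Finset κ) (k : κ) : Measurable fun ω => quadForm (orthProj fun i : T => H i ω) (H k ω) := by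
  have h1 : Measurable fun ω (i : T) => H i ω := measurable_pi_lambda _ fun i => hH.measurable i
  have h2 := measurable_quadForm_orthProj (m := Fin M) (ι := T)
  exact h2.comp (h1.prodMk (hH.measurable k))

variable [IsProbabilityMeasure μ]

/-- Averaging over one of the vectors first. -/
lemma IsGaussianEstimates.lintegral_eq (hH : IsGaussianEstimates H c μ) {T : Finset κ} {k : κ}
    (hk : k ∉ T) {f : (T → Fin M → ℂ) × (Fin M → ℂ) → ℝ≥0∞} (hf : Measurable f) :
    ∫⁻ ω, f (fun i => H i ω, H k ω) ∂μ
      = ∫⁻ ω, ∫⁻ x, f (fun i => H i ω, (c k : ℂ) • x) ∂(stdComplexGaussianVec (Fin M)) ∂μ := by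
  obtain ⟨Z, hZ, hi, hl, h⟩ := hH.exists_std
  -- Independence of `Z k` from the family over `T` turns the joint law into a product, and Tonelli
  -- then plays the role of conditioning on the estimates in `T`.
  have hind : IndepFun (fun ω (i : T) => Z i ω) (fun ω => Z k ω) μ := by
    have h1 := hi.indepFun_finset T {k} (by simpa using hk) hZ
    exact h1.comp (φ := id) (ψ := fun z : ({k} : Finset κ) → Fin M → ℂ => z ⟨k, by simp⟩)
      measurable_id (by fun_prop)
  have hmZ : Measurable fun ω (i : T) => Z i ω := measurable_pi_lambda _ fun i => hZ i
  rw [indepFun_iff_map_prod_eq_prod_map_map hmZ.aemeasurable (hZ k).aemeasurable, hl k] at hind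
  set g : (T → Fin M → ℂ) × (Fin M → ℂ) → ℝ≥0∞ :=
    fun p => f (fun i => (c i : ℂ) • p.1 i, (c k : ℂ) • p.2) with hg
  have hgm : Measurable g := by
    refine hf.comp (Measurable.prodMk ?_ (by fun_prop))
    refine measurable_pi_lambda _ fun i => ?_
    fun_prop
  have e1 : ∫⁻ ω, f (fun i => H i ω, H k ω) ∂μ
      = ∫⁻ p, g p ∂(μ.map fun ω => ((fun i : T => Z i ω), Z k ω)) := by
    rw [lintegral_map hgm (hmZ.prodMk (hZ k))]
    simp only [hg, h]
  rw [e1, hind, lintegral_prod _ hgm.aemeasurable, lintegral_map hgm.lintegral_prod_right' hmZ]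
  simp only [hg, h]

variable [DecidableEq κ]

/-- Almost surely the estimates of fewer than `M` users are linearly independent. -/
lemma IsGaussianEstimates.ae_linearIndepOn (hH : IsGaussianEstimates H c μ) (T : Finset κ)
    (hT : T.card < M) : ∀ᵐ ω ∂μ, LinearIndepOn ℂ (fun j => H j ω) (T : Set κ) := by
  induction T using Finset.induction_on with
  | empty => simp
  | insert k T hk ih =>
    rw [Finset.card_insert_of_notMem hk] at hT
    have ih := ih (by omega)
    -- Before the insertion of `k` the complement has dimension at least two, so the inverse
    -- quadratic form has finite mean and is almost surely finite. If `H k` were in the span, the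
    -- form would vanish and its inverse would be `∞`.
    obtain ⟨n, hn⟩ : ∃ n, T.card + (n + 2) = M := ⟨M - T.card - 2, by omega⟩
    have hm : Measurable fun p : (T → Fin M → ℂ) × (Fin M → ℂ) =>
        (ENNReal.ofReal (quadForm (orthProj p.1) p.2))⁻¹ :=
      measurable_quadForm_orthProj.ennreal_ofReal.inv
    have hck := hH.pos k
    have hlin : ∫⁻ ω, (ENNReal.ofReal (quadForm (orthProj fun i : T => H i ω) (H k ω)))⁻¹ ∂μ
        ≠ ∞ := by
      rw [hH.lintegral_eq hk hm]
      have : ∀ᵐ ω ∂μ, ∫⁻ x, (ENNReal.ofReal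
          (quadForm (orthProj fun i : T => H i ω) ((c k : ℂ) • x)))⁻¹
            ∂(stdComplexGaussianVec (Fin M))
          = (ENNReal.ofReal (c k ^ 2))⁻¹ * ENNReal.ofReal (1 / (n + 1)) := by
        filter_upwards [ih] with ω hω
        have hx : ∀ x, (ENNReal.ofReal (quadForm (orthProj fun i : T => H i ω) ((c k : ℂ) • x)))⁻¹
            = (ENNReal.ofReal (c k ^ 2))⁻¹
              * (ENNReal.ofReal (quadForm (orthProj fun i : T => H i ω) x))⁻¹ := fun x => by
          rw [quadForm_smul, ENNReal.ofReal_mul (by positivity), ENNReal.mul_inv]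
          · left; simp; positivity
          · left; simp
        simp_rw [hx]
        rw [lintegral_const_mul _ (by fun_prop),
          lintegral_inv_quadForm_orthProj (H := fun i : T => H i ω) hω (by simpa using hn)]
      rw [lintegral_congr_ae this, lintegral_const, measure_univ, mul_one]
      refine ENNReal.mul_ne_top (ENNReal.inv_ne_top.mpr ?_) ENNReal.ofReal_ne_top
      simp; positivity
    have hHT : Measurable fun ω (i : T) => H i ω := measurable_pi_lambda _ fun i => hH.measurable i
    have hae := ae_lt_top' (hm.comp (hHT.prodMk (hH.measurable k))).aemeasurable hlin
    filter_upwards [ih, hae] with ω h1 h2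
    rw [Finset.coe_insert]
    refine h1.insert ?_
    intro hmem
    have hz : orthProj (fun i : T => H i ω) *ᵥ H k ω = 0 := by
      refine orthProj_mulVec_eq_zero_of_mem_span (H := fun i : T => H i ω) h1 ?_
      have : (fun j => H j ω) '' (T : Set κ) = Set.range fun i : T => H i ω := by
        rw [Set.image_eq_range]; rfl
      rwa [this] at hmem
    simp [quadForm, hz] at h2

/-- Mean power of the protective maximum-ratio precoding vector. -/
lemma IsGaussianEstimates.lintegral_precoder_of_notMem (hH : IsGaussianEstimates H c μ)
    {S : Finset κ} {n : ℕ} (hn : S.card + (n + 1) = M) {k : κ} (hk : k ∉ S) :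
    ∫⁻ ω, ENNReal.ofReal (∑ a, ‖precoder S (fun j => H j ω) k a‖ ^ 2) ∂μ
      = ENNReal.ofReal (c k ^ 2 * (n + 1)) := by
  have hli := hH.ae_linearIndepOn S (by omega)
  have e1 : ∫⁻ ω, ENNReal.ofReal (∑ a, ‖precoder S (fun j => H j ω) k a‖ ^ 2) ∂μ
      = ∫⁻ ω, ENNReal.ofReal (quadForm (orthProj fun i : S => H i ω) (H k ω)) ∂μ := by
    refine lintegral_congr_ae ?_
    filter_upwards [hli] with ω hω
    rw [← sum_norm_sq_mulVec (orthProj_isHermitian _) (orthProj_mul_self (H := fun i : S => H i ω)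
      hω)]
    simp [precoder, hk]
  rw [e1, hH.lintegral_eq hk (f := fun p => ENNReal.ofReal (quadForm (orthProj p.1) p.2))
    measurable_quadForm_orthProj.ennreal_ofReal]
  have : ∀ᵐ ω ∂μ, ∫⁻ x, ENNReal.ofReal
      (quadForm (orthProj fun i : S => H i ω) ((c k : ℂ) • x)) ∂(stdComplexGaussianVec (Fin M))
      = ENNReal.ofReal (c k ^ 2 * (n + 1)) := by
    filter_upwards [hli] with ω hω
    simp_rw [quadForm_smul, ENNReal.ofReal_mul (sq_nonneg (c k))]
    rw [lintegral_const_mul _ (by fun_prop),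
      lintegral_quadForm_orthProj (H := fun i : S => H i ω) hω (n := n + 1) (by simpa using hn),
      ← ENNReal.ofReal_natCast]
    push_cast
    rfl
  rw [lintegral_congr_ae this, lintegral_const, measure_univ, mul_one]

/-- The estimated gain of a weak user for its own signal is a multiple of this quadratic form, so
its power needs the second moment. -/
lemma IsGaussianEstimates.lintegral_quadForm_sq (hH : IsGaussianEstimates H c μ)
    {S : Finset κ} {n : ℕ} (hn : S.card + (n + 1) = M) {k : κ} (hk : k ∉ S) :
    ∫⁻ ω, ENNReal.ofReal (quadForm (orthProj fun i : S => H i ω) (H k ω) ^ 2) ∂μ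
      = ENNReal.ofReal (c k ^ 4 * ((n + 1) * (n + 2))) := by
  have hli := hH.ae_linearIndepOn S (by omega)
  rw [hH.lintegral_eq hk (f := fun p => ENNReal.ofReal (quadForm (orthProj p.1) p.2 ^ 2))
    (measurable_quadForm_orthProj.pow_const 2).ennreal_ofReal]
  have : ∀ᵐ ω ∂μ, ∫⁻ x, ENNReal.ofReal
      (quadForm (orthProj fun i : S => H i ω) ((c k : ℂ) • x) ^ 2) ∂(stdComplexGaussianVec (Fin M))
      = ENNReal.ofReal (c k ^ 4 * ((n + 1) * (n + 2))) := by
    filter_upwards [hli] with ω hω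
    simp_rw [quadForm_smul, mul_pow, ENNReal.ofReal_mul (sq_nonneg (c k ^ 2))]
    rw [lintegral_const_mul _ (by fun_prop),
      lintegral_quadForm_orthProj_sq (H := fun i : S => H i ω) hω (n := n + 1) (by simpa using hn),
      ENNReal.ofReal_mul (by positivity), ← pow_mul]
    have h2 : ((n + 1 : ℕ) * ((n + 1 : ℕ) + 1) : ℝ≥0∞) = ENNReal.ofReal ((n + 1) * (n + 2)) := by
      rw [show ((n : ℝ) + 1) * (n + 2) = (((n + 1) * (n + 1 + 1) : ℕ) : ℝ) by push_cast; ring,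
        ENNReal.ofReal_natCast]
      push_cast
      rfl
    rw [h2]
  rw [lintegral_congr_ae this, lintegral_const, measure_univ, mul_one]

/-- Mean power of the zero-forcing precoding vector. -/
lemma IsGaussianEstimates.lintegral_precoder_of_mem (hH : IsGaussianEstimates H c μ)
    {S : Finset κ} {n : ℕ} (hn : S.card + (n + 1) = M) {k : κ} (hk : k ∈ S) :
    ∫⁻ ω, ENNReal.ofReal (∑ a, ‖precoder S (fun j => H j ω) k a‖ ^ 2) ∂μ
      = ENNReal.ofReal (1 / (c k ^ 2 * (n + 1))) := by
  have hck := hH.pos k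
  have hli := hH.ae_linearIndepOn S (by omega)
  have hliT := hH.ae_linearIndepOn (S.erase k) (by have := S.card_erase_le (a := k); omega)
  -- Only the other strong users are projected out, so the rank is `n + 2` rather than `n + 1`, and
  -- the inverse moment is `1 / (n + 1)`.
  have hcard : (S.erase k).card + (n + 2) = M := by
    rw [← hn, ← Finset.card_erase_add_one hk]; ring
  have e1 : ∫⁻ ω, ENNReal.ofReal (∑ a, ‖precoder S (fun j => H j ω) k a‖ ^ 2) ∂μ
      = ∫⁻ ω, (ENNReal.ofReal
          (quadForm (orthProj fun i : S.erase k => H i ω) (H k ω)))⁻¹ ∂μ := by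
    refine lintegral_congr_ae ?_
    filter_upwards [hli, hliT] with ω hω hωT
    obtain ⟨h0, h1⟩ := colMatrix_mul_gram_inv_mulVec_single hω hk
    have h2 := quadForm_orthProj_nonneg (H := fun i : S.erase k => H i ω) hωT (H k ω)
    rw [← ENNReal.ofReal_inv_of_pos (lt_of_le_of_ne h2 h0.symm), ← h1]
    simp [precoder, hk]
  rw [e1, hH.lintegral_eq (S.notMem_erase k)
    (f := fun p => (ENNReal.ofReal (quadForm (orthProj p.1) p.2))⁻¹)
    measurable_quadForm_orthProj.ennreal_ofReal.inv]
  have : ∀ᵐ ω ∂μ, ∫⁻ x, (ENNReal.ofReal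
      (quadForm (orthProj fun i : S.erase k => H i ω) ((c k : ℂ) • x)))⁻¹
        ∂(stdComplexGaussianVec (Fin M)) = ENNReal.ofReal (1 / (c k ^ 2 * (n + 1))) := by
    filter_upwards [hliT] with ω hω
    have hx : ∀ x, (ENNReal.ofReal
        (quadForm (orthProj fun i : S.erase k => H i ω) ((c k : ℂ) • x)))⁻¹
        = (ENNReal.ofReal (c k ^ 2))⁻¹
          * (ENNReal.ofReal (quadForm (orthProj fun i : S.erase k => H i ω) x))⁻¹ := fun x => by
      rw [quadForm_smul, ENNReal.ofReal_mul (by positivity), ENNReal.mul_inv]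
      · left; simp; positivity
      · left; simp
    simp_rw [hx]
    rw [lintegral_const_mul _ (by fun_prop),
      lintegral_inv_quadForm_orthProj (H := fun i : S.erase k => H i ω) hω (n := n)
        (by simpa using hcard),
      ← ENNReal.ofReal_inv_of_pos (by positivity), ← ENNReal.ofReal_mul (by positivity)]
    congr 1
    field_simp
  rw [lintegral_congr_ae this, lintegral_const, measure_univ, mul_one]

end GaussianEstimates

-- Second-order calculus for uncorrelated families.

section SecondMoments

variable {Ω : Type*} [MeasurableSpace Ω] {μ : Measure Ω}

lemma integrable_mul_star {f g : Ω → ℂ} (hf : MemLp f 2 μ) (hg : MemLp g 2 μ) :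
    Integrable (fun ω => f ω * star (g ω)) μ :=
  hf.integrable_mul hg.star

/-- Pythagoras for pairwise orthogonal square-integrable random variables. -/
lemma integral_norm_sum_sq {ι : Type*} (s : Finset ι) {b : ι → Ω → ℂ}
    (hb : ∀ i ∈ s, MemLp (b i) 2 μ)
    (ho : ∀ i ∈ s, ∀ j ∈ s, i ≠ j → ∫ ω, b i ω * star (b j ω) ∂μ = 0) :
    ∫ ω, ‖∑ i ∈ s, b i ω‖ ^ 2 ∂μ = ∑ i ∈ s, ∫ ω, ‖b i ω‖ ^ 2 ∂μ := by
  have hsq : ∀ z : ℂ, ((‖z‖ ^ 2 : ℝ) : ℂ) = z * star z := fun z => by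
    rw [Complex.star_def, Complex.mul_conj']; push_cast; rfl
  have hofReal : ∀ f : Ω → ℝ, ((∫ ω, f ω ∂μ : ℝ) : ℂ) = ∫ ω, (f ω : ℂ) ∂μ :=
    fun f => integral_ofReal.symm
  rw [← Complex.ofReal_inj, Complex.ofReal_sum]
  simp_rw [hofReal, hsq, star_sum, Finset.sum_mul_sum]
  rw [integral_finsetSum _ fun i hi => integrable_finsetSum _ fun j hj =>
    integrable_mul_star (hb i hi) (hb j hj)]
  refine Finset.sum_congr rfl fun i hi => ?_
  rw [integral_finsetSum _ fun j hj => integrable_mul_star (hb i hi) (hb j hj),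
    Finset.sum_eq_single i (fun j hj hij => ho i hi j hj hij.symm) (fun h => absurd hi h)]

lemma integral_norm_add_sq {f g : Ω → ℂ} (hf : MemLp f 2 μ) (hg : MemLp g 2 μ)
    (ho : ∫ ω, f ω * star (g ω) ∂μ = 0) :
    ∫ ω, ‖f ω + g ω‖ ^ 2 ∂μ = (∫ ω, ‖f ω‖ ^ 2 ∂μ) + ∫ ω, ‖g ω‖ ^ 2 ∂μ := by
  have ho' : ∫ ω, g ω * star (f ω) ∂μ = 0 := by
    have h : ∀ ω, g ω * star (f ω) = star (f ω * star (g ω)) := fun ω => by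
      rw [star_mul, star_star]
    simp_rw [h, Complex.star_def]
    rw [integral_conj]
    simp only [Complex.star_def] at ho
    rw [ho, map_zero]
  have h := integral_norm_sum_sq (μ := μ) Finset.univ (b := ![f, g])
    (by intro i _; fin_cases i <;> simpa)
    (by intro i _ j _ hij; fin_cases i <;> fin_cases j <;> simp_all)
  simpa using h

lemma memLp_two_mul_of_indepFun {f g : Ω → ℂ} (h : IndepFun f g μ) (hf : MemLp f 2 μ)
    (hg : MemLp g 2 μ) : MemLp (fun ω => f ω * g ω) 2 μ := by
  refine (memLp_two_iff_integrable_sq_norm (hf.1.mul hg.1)).mpr ?_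
  have h1 := (memLp_two_iff_integrable_sq_norm hf.1).mp hf
  have h2 := (memLp_two_iff_integrable_sq_norm hg.1).mp hg
  have h3 : IndepFun (fun ω => ‖f ω‖ ^ 2) (fun ω => ‖g ω‖ ^ 2) μ :=
    h.comp (φ := fun z : ℂ => ‖z‖ ^ 2) (ψ := fun z : ℂ => ‖z‖ ^ 2) (by fun_prop) (by fun_prop)
  refine (h3.integrable_mul h1 h2).congr (.of_forall fun ω => ?_)
  simp [mul_pow]

/-- An uncorrelated family of unit power. -/
structure IsWhite {ι : Type*} (e : ι → Ω → ℂ) (μ : Measure Ω) : Prop where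
  memLp : ∀ i, MemLp (e i) 2 μ
  power : ∀ i, ∫ ω, ‖e i ω‖ ^ 2 ∂μ = 1
  uncorrelated : ∀ i j, i ≠ j → ∫ ω, e i ω * star (e j ω) ∂μ = 0

variable {ι : Type*} [Fintype ι] {e w : ι → Ω → ℂ}

lemma IsWhite.memLp_sum_mul (he : IsWhite e μ)
    (hw : ∀ i, MemLp (w i) 2 μ) (hi : IndepFun (fun ω i => e i ω) (fun ω i => w i ω) μ) :
    MemLp (fun ω => ∑ i, e i ω * w i ω) 2 μ :=
  memLp_finsetSum _ fun i _ => memLp_two_mul_of_indepFun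
    (hi.comp (φ := fun z : ι → ℂ => z i) (ψ := fun z : ι → ℂ => z i) (by fun_prop) (by fun_prop)) (he.memLp i) (hw i)

/-- Each cross term factors into a correlation of `e` and one of `w`, and the former vanishes.
Neither zero mean nor independence within `e` is needed, so this serves both for Gaussian vectors
and for data symbols. -/
lemma IsWhite.integral_norm_sum_mul_sq (he : IsWhite e μ)
    (hw : ∀ i, MemLp (w i) 2 μ) (hi : IndepFun (fun ω i => e i ω) (fun ω i => w i ω) μ) :
    ∫ ω, ‖∑ i, e i ω * w i ω‖ ^ 2 ∂μ = ∑ i, ∫ ω, ‖w i ω‖ ^ 2 ∂μ := by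
  have hii : ∀ i, IndepFun (e i) (w i) μ := fun i =>
    hi.comp (φ := fun z : ι → ℂ => z i) (ψ := fun z : ι → ℂ => z i) (by fun_prop) (by fun_prop)
  rw [integral_norm_sum_sq _ fun i _ => memLp_two_mul_of_indepFun (hii i) (he.memLp i) (hw i)]
  · refine Finset.sum_congr rfl fun i _ => ?_
    have h3 : IndepFun (fun ω => ‖e i ω‖ ^ 2) (fun ω => ‖w i ω‖ ^ 2) μ :=
      (hii i).comp (φ := fun z : ℂ => ‖z‖ ^ 2) (ψ := fun z : ℂ => ‖z‖ ^ 2) (by fun_prop)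
        (by fun_prop)
    simp_rw [norm_mul, mul_pow]
    rw [h3.integral_fun_mul_eq_mul_integral ((he.memLp i).1.norm.pow 2) ((hw i).1.norm.pow 2),
      he.power, one_mul]
  · intro i _ j _ hij
    have h3 : IndepFun (fun ω => e i ω * star (e j ω)) (fun ω => w i ω * star (w j ω)) μ :=
      hi.comp (φ := fun z : ι → ℂ => z i * star (z j)) (ψ := fun z : ι → ℂ => z i * star (z j))
        (by fun_prop) (by fun_prop)
    have h4 : ∀ ω, e i ω * w i ω * star (e j ω * w j ω)
        = (e i ω * star (e j ω)) * (w i ω * star (w j ω)) := fun ω => by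
      rw [star_mul']; ring
    simp_rw [h4]
    rw [h3.integral_fun_mul_eq_mul_integral ((he.memLp i).1.mul (he.memLp j).1.star)
      ((hw i).1.mul (hw j).1.star), he.uncorrelated i j hij, zero_mul]

/-- A white, centered family independent of `(w, c)` contributes an orthogonal term. -/
lemma IsWhite.integral_sum_mul_mul_star (he : IsWhite e μ) (h0 : ∀ i, ∫ ω, e i ω ∂μ = 0)
    (hw : ∀ i, MemLp (w i) 2 μ) {c : Ω → ℂ} (hc : MemLp c 2 μ)
    (hi : IndepFun (fun ω i => e i ω) (fun ω => ((fun i => w i ω), c ω)) μ) :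
    ∫ ω, (∑ i, e i ω * w i ω) * star (c ω) ∂μ = 0 := by
  have hii : ∀ i, IndepFun (e i) (w i) μ := fun i =>
    hi.comp (φ := fun z : ι → ℂ => z i) (ψ := fun z : (ι → ℂ) × ℂ => z.1 i) (by fun_prop) (by fun_prop)
  simp_rw [Finset.sum_mul]
  rw [integral_finsetSum _ fun i _ => integrable_mul_star
    (memLp_two_mul_of_indepFun (hii i) (he.memLp i) (hw i)) hc]
  refine Finset.sum_eq_zero fun i _ => ?_
  have h3 : IndepFun (e i) (fun ω => w i ω * star (c ω)) μ :=
    hi.comp (φ := fun z : ι → ℂ => z i) (ψ := fun z : (ι → ℂ) × ℂ => z.1 i * star z.2) (by fun_prop) (by fun_prop)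
  simp_rw [mul_assoc]
  rw [h3.integral_fun_mul_eq_mul_integral (he.memLp i).1 ((hw i).1.mul hc.1.star), h0, zero_mul]

lemma IsWhite.integral_sum_mul (he : IsWhite e μ) (h0 : ∀ i, ∫ ω, e i ω ∂μ = 0)
    [IsProbabilityMeasure μ]
    (hw : ∀ i, MemLp (w i) 2 μ) (hi : IndepFun (fun ω i => e i ω) (fun ω i => w i ω) μ) :
    ∫ ω, ∑ i, e i ω * w i ω ∂μ = 0 := by
  have h := he.integral_sum_mul_mul_star h0 hw (c := fun _ => 1) (memLp_const 1)
    (hi.comp (φ := id) (ψ := fun z => (z, (1 : ℂ))) measurable_id (by fun_prop))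
  simpa using h

/-- The conjugated entries of a standard complex Gaussian vector are white and centered. -/
lemma isWhite_star_of_map_eq [IsProbabilityMeasure μ] {V : Ω → ι → ℂ} (hV : Measurable V)
    (hl : μ.map V = stdComplexGaussianVec ι) :
    IsWhite (fun i ω => star (V ω i)) μ ∧ ∀ i, ∫ ω, star (V ω i) ∂μ = 0 := by
  have hVi : ∀ i, Measurable fun ω => V ω i := fun i => by fun_prop
  have hli : ∀ i, μ.map (fun ω => V ω i) = stdComplexGaussian := fun i => by
    have h1 : (fun ω => V ω i) = (fun z : ι → ℂ => z i) ∘ V := rfl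
    rw [h1, ← Measure.map_map (by fun_prop) hV, hl]
    exact (measurePreserving_eval (fun _ : ι => stdComplexGaussian) i).map_eq
  have hind : iIndepFun (fun i ω => V ω i) μ := by
    rw [iIndepFun_iff_map_fun_eq_pi_map (fun i => (hVi i).aemeasurable)]
    simp_rw [hli]
    exact hl
  have hmem : ∀ i, MemLp (fun ω => V ω i) 2 μ := fun i => by
    have h := memLp_id_stdComplexGaussian
    rw [← hli i, memLp_map_measure_iff (by fun_prop) (hVi i).aemeasurable] at h
    exact h
  have hmean : ∀ i, ∫ ω, V ω i ∂μ = 0 := fun i => by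
    rw [← integral_id_stdComplexGaussian, ← hli i, integral_map (hVi i).aemeasurable (by fun_prop)]
  have hmean' : ∀ i, ∫ ω, star (V ω i) ∂μ = 0 := fun i => by
    simp only [Complex.star_def]
    rw [integral_conj, hmean, map_zero]
  refine ⟨⟨fun i => (hmem i).star, fun i => ?_, fun i j hij => ?_⟩, hmean'⟩
  · simp only [norm_star]
    rw [← integral_norm_sq_stdComplexGaussian, ← hli i,
      integral_map (hVi i).aemeasurable (by fun_prop)]
  · have h3 : IndepFun (fun ω => star (V ω i)) (fun ω => star (star (V ω j))) μ :=
      (hind.indepFun hij).comp (φ := fun z => star z) (ψ := fun z => star (star z)) (by fun_prop)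
        (by fun_prop)
    rw [h3.integral_fun_mul_eq_mul_integral (hmem i).star.1 (hmem j).star.star.1, hmean' i,
      zero_mul]

end SecondMoments

lemma Block.IsRayleigh.map_g {L K M τ : ℕ} {Ω : Type*} [MeasurableSpace Ω] {μ : Measure Ω}
    [IsProbabilityMeasure μ] {X : Block L K M τ Ω} (hX : X.IsRayleigh μ) (l : Fin L) (k : Fin K) :
    (Measurable fun ω m => X.g l k m ω) ∧
      μ.map (fun ω m => X.g l k m ω) = stdComplexGaussianVec (Fin M) := by
  have hm : ∀ m, Measurable (X.g l k m) := fun m => hX.measurable (.inl (l, k, m))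
  refine ⟨measurable_pi_lambda _ hm, ?_⟩
  have h := hX.indep.precomp (g := fun m : Fin M => Sum.inl (l, k, m))
    (fun a b h => by simpa using h)
  rw [iIndepFun_iff_map_fun_eq_pi_map (fun i => (hX.measurable _).aemeasurable)] at h
  have h2 : (fun ω m => X.g l k m ω) = fun ω m => X.family (.inl (l, k, m)) ω := rfl
  rw [h2, h]
  simp_rw [hX.law]

lemma Params.u_eq_precoder {L K M τ : ℕ} [NeZero K] {Ω : Type*} (P : Params L K M τ)
    (X : Block L K M τ Ω) (l : Fin L) (k : Fin K) :
    P.u X l k = (fun H => precoder (P.S l) H k) ∘ fun ω j => P.hhat X l j ω := rfl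

-- Normalized precoders and the contribution of the estimation error.

section Gains

variable {L K M τ : ℕ} {Ω : Type*} [MeasurableSpace Ω] {μ : Measure Ω}
  {P : Params L K M τ} {X : Block L K M τ Ω}

/-- The standing assumptions on the parameters. -/
structure Params.IsValid (P : Params L K M τ) : Prop where
  β_pos : ∀ l k, 0 < P.β l k
  βE_nonneg : ∀ l, 0 ≤ P.βE l
  ρu_pos : 0 < P.ρu
  ρE_nonneg : 0 ≤ P.ρE
  ρ_nonneg : ∀ l k, 0 ≤ P.ρ l k
  orthonormal : Orthonormal ℂ P.φ
  card_lt : ∀ l, (P.S l).card < M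

namespace Params.IsValid

lemma sub_card_pos (hP : P.IsValid) (l : Fin L) : (0 : ℝ) < M - (P.S l).card := by
  have := hP.card_lt l
  rw [sub_pos]
  exact_mod_cast this

lemma exists_rank (hP : P.IsValid) (l : Fin L) :
    ∃ n : ℕ, (P.S l).card + (n + 1) = M ∧ (n + 1 : ℝ) = M - (P.S l).card := by
  obtain ⟨n, hn⟩ := Nat.exists_eq_add_of_lt (hP.card_lt l)
  refine ⟨n, by omega, ?_⟩
  have h : (M : ℝ) = (P.S l).card + n + 1 := by exact_mod_cast hn
  linarith

variable [NeZero K]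

lemma γ_pos (hP : P.IsValid) (l : Fin L) (k : Fin K) : 0 < P.γ l k :=
  P.γ_pos hP.β_pos hP.βE_nonneg hP.ρu_pos hP.ρE_nonneg
    (P.tau_pos_of_orthonormal hP.orthonormal) l k

lemma γ_lt_β (hP : P.IsValid) (l : Fin L) (k : Fin K) : P.γ l k < P.β l k :=
  P.γ_lt_β hP.β_pos hP.βE_nonneg hP.ρu_pos hP.ρE_nonneg l k

variable [IsProbabilityMeasure μ]

lemma isGaussianEstimates (hP : P.IsValid) (hX : X.IsRayleigh μ) (l : Fin L) :
    IsGaussianEstimates (fun j ω => P.hhat X l j ω) (fun j => √(P.γ l j)) μ := by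
  -- The user `0` whose error is included is arbitrary, since the error component is dropped.
  obtain ⟨Z, hZ, hi, hl, hh, -⟩ := P.exists_gaussian_representation hP.β_pos hP.βE_nonneg
    hP.ρu_pos hP.ρE_nonneg hP.orthonormal hX l 0
  exact ⟨fun j => Real.sqrt_pos.mpr (hP.γ_pos l j), fun j => Z (some j), fun j => hZ _,
    hi.precomp (Option.some_injective _), fun j => hl _, hh⟩

lemma measurable_hhat (hP : P.IsValid) (hX : X.IsRayleigh μ) (l : Fin L) :
    Measurable fun ω j => P.hhat X l j ω :=
  measurable_pi_lambda _ fun j => (hP.isGaussianEstimates hX l).measurable j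

/-- The estimation error is a scaled standard Gaussian vector independent of the estimates. -/
lemma exists_error (hP : P.IsValid) (hX : X.IsRayleigh μ) (l : Fin L) (k : Fin K) :
    ∃ e : Ω → Fin M → ℂ, Measurable e ∧ μ.map e = stdComplexGaussianVec (Fin M) ∧
      IndepFun e (fun ω j => P.hhat X l j ω) μ ∧
      ∀ ω, P.h X l k ω = P.hhat X l k ω + (√(P.β l k - P.γ l k) : ℂ) • e ω := by
  obtain ⟨Z, hZ, hi, hl, hh, hk⟩ := P.exists_gaussian_representation hP.β_pos hP.βE_nonneg
    hP.ρu_pos hP.ρE_nonneg hP.orthonormal hX l k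
  refine ⟨Z none, hZ none, hl none, ?_, hk⟩
  have h1 := hi.indepFun_finset {none} (Finset.univ.erase none) (by simp) hZ
  have hφ : Measurable fun z : ({none} : Finset (Option (Fin K))) → Fin M → ℂ =>
      z ⟨none, by simp⟩ := by fun_prop
  have h2 := h1.comp hφ
    (ψ := fun (z : (Finset.univ.erase (none : Option (Fin K)) : Finset _) → Fin M → ℂ)
      (j : Fin K) => (√(P.γ l j) : ℂ) • z ⟨some j, by simp⟩)
    (measurable_pi_lambda _ fun j => by fun_prop)
  have h3 : (fun ω j => P.hhat X l j ω) = fun ω j => (√(P.γ l j) : ℂ) • Z (some j) ω := by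
    funext ω j; exact hh j ω
  rw [h3]
  exact h2

/-- The channel of user `k` is independent of the estimates of the other users. -/
lemma indepFun_h_hhat (hP : P.IsValid) (hX : X.IsRayleigh μ) (l : Fin L) (k : Fin K) :
    IndepFun (P.h X l k) (fun ω (j : {j : Fin K // j ≠ k}) => P.hhat X l j ω) μ := by
  obtain ⟨Z, hZ, hi, hl, hh, hk⟩ := P.exists_gaussian_representation hP.β_pos hP.βE_nonneg
    hP.ρu_pos hP.ρE_nonneg hP.orthonormal hX l k
  have h1 := hi.indepFun_finset {none, some k} ({none, some k}ᶜ) disjoint_compl_right hZ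
  have h2 := h1.comp
    (φ := fun z : ({none, some k} : Finset (Option (Fin K))) → Fin M → ℂ =>
      (√(P.γ l k) : ℂ) • z ⟨some k, by simp⟩
        + (√(P.β l k - P.γ l k) : ℂ) • z ⟨none, by simp⟩)
    (ψ := fun (z : (({none, some k}ᶜ : Finset (Option (Fin K)))) → Fin M → ℂ)
      (j : {j : Fin K // j ≠ k}) => (√(P.γ l j) : ℂ) • z ⟨some j, by simp [j.2]⟩)
    (by fun_prop) (measurable_pi_lambda _ fun j => by fun_prop)
  have h3 : (fun ω (j : {j : Fin K // j ≠ k}) => P.hhat X l j ω)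
      = fun ω (j : {j : Fin K // j ≠ k}) => (√(P.γ l j) : ℂ) • Z (some j) ω := by
    funext ω j; exact hh j ω
  have h4 : P.h X l k = fun ω => (√(P.γ l k) : ℂ) • Z (some k) ω
      + (√(P.β l k - P.γ l k) : ℂ) • Z none ω := by
    funext ω; rw [hk, hh]
  rw [h3, h4]
  exact h2

lemma measurable_u (hP : P.IsValid) (hX : X.IsRayleigh μ) (l : Fin L) (t : Fin K) :
    Measurable (P.u X l t) := by
  rw [P.u_eq_precoder]
  exact (measurable_precoder (P.S l) t).comp (hP.measurable_hhat hX l)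

/-- The mean power of the precoding vectors before normalization. -/
lemma integral_u (hP : P.IsValid) (hX : X.IsRayleigh μ) (l : Fin L) (t : Fin K) :
    Integrable (fun ω => ∑ m, ‖P.u X l t ω m‖ ^ 2) μ ∧
    ∫ ω, ∑ m, ‖P.u X l t ω m‖ ^ 2 ∂μ = if t ∈ P.S l then 1 / (P.γ l t * (M - (P.S l).card))
      else P.γ l t * (M - (P.S l).card) := by
  obtain ⟨n, hn, hN⟩ := hP.exists_rank l
  have hγ := hP.γ_pos l t
  have hu := hP.measurable_u hX l t
  have hE := hP.isGaussianEstimates hX l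
  have hm : Measurable fun ω => ∑ m, ‖P.u X l t ω m‖ ^ 2 := by fun_prop
  have hnn : 0 ≤ᵐ[μ] fun ω => ∑ m, ‖P.u X l t ω m‖ ^ 2 := .of_forall fun ω => by positivity
  have hv : ∫⁻ ω, ENNReal.ofReal (∑ m, ‖P.u X l t ω m‖ ^ 2) ∂μ
      = ENNReal.ofReal (if t ∈ P.S l then 1 / (P.γ l t * (M - (P.S l).card))
      else P.γ l t * (M - (P.S l).card)) := by
    rw [← hN]
    split_ifs with ht
    · have h := hE.lintegral_precoder_of_mem hn ht
      rw [Real.sq_sqrt hγ.le] at h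
      exact h
    · have h := hE.lintegral_precoder_of_notMem hn ht
      rw [Real.sq_sqrt hγ.le] at h
      exact h
  refine ⟨⟨hm.aestronglyMeasurable, ?_⟩, ?_⟩
  · rw [hasFiniteIntegral_iff_ofReal hnn, hv]
    exact ENNReal.ofReal_lt_top
  · rw [integral_eq_lintegral_of_nonneg_ae hnn hm.aestronglyMeasurable, hv, ENNReal.toReal_ofReal]
    rw [← hN]
    split_ifs <;> positivity

/-- The normalization of the precoding vectors. -/
lemma w_eq (hP : P.IsValid) (hX : X.IsRayleigh μ) (l : Fin L) (t : Fin K) (ω : Ω) :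
    P.w X μ l t ω = ((if t ∈ P.S l then √(P.γ l t * (M - (P.S l).card))
      else 1 / √(P.γ l t * (M - (P.S l).card)) : ℝ) : ℂ) • P.u X l t ω := by
  rw [Params.w, (hP.integral_u hX l t).2]
  split_ifs
  · rw [Real.sqrt_div zero_le_one, Real.sqrt_one, one_div_one_div]
  · rfl

lemma integral_w (hP : P.IsValid) (hX : X.IsRayleigh μ) (l : Fin L) (t : Fin K) :
    Integrable (fun ω => ∑ m, ‖P.w X μ l t ω m‖ ^ 2) μ ∧
      ∫ ω, ∑ m, ‖P.w X μ l t ω m‖ ^ 2 ∂μ = 1 := by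
  obtain ⟨hi, hv⟩ := hP.integral_u hX l t
  have hpos : 0 < ∫ ω, ∑ m, ‖P.u X l t ω m‖ ^ 2 ∂μ := by
    rw [hv]
    have := hP.γ_pos l t
    have := hP.sub_card_pos l
    split_ifs <;> positivity
  set p := ∫ ω, ∑ m, ‖P.u X l t ω m‖ ^ 2 ∂μ with hp
  have hw : ∀ ω, ∑ m, ‖P.w X μ l t ω m‖ ^ 2 = p⁻¹ * ∑ m, ‖P.u X l t ω m‖ ^ 2 := fun ω => by
    rw [Finset.mul_sum]
    refine Finset.sum_congr rfl fun m _ => ?_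
    rw [Params.w, Pi.smul_apply, norm_smul, mul_pow, ← hp, Complex.norm_real, Real.norm_eq_abs,
      sq_abs, div_pow, Real.sq_sqrt hpos.le]
    ring
  simp_rw [hw]
  refine ⟨hi.const_mul _, ?_⟩
  rw [integral_const_mul, ← hp, inv_mul_cancel₀ hpos.ne']

lemma measurable_w (hP : P.IsValid) (hX : X.IsRayleigh μ) (l : Fin L) (t : Fin K) :
    Measurable (P.w X μ l t) := by
  have := hP.measurable_u hX l t
  unfold Params.w
  fun_prop

lemma memLp_w (hP : P.IsValid) (hX : X.IsRayleigh μ) (l : Fin L) (t : Fin K) (m : Fin M) :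
    MemLp (fun ω => P.w X μ l t ω m) 2 μ := by
  have hm := hP.measurable_w hX l t
  have hm' : Measurable fun ω => P.w X μ l t ω m := by fun_prop
  rw [memLp_two_iff_integrable_sq_norm hm'.aestronglyMeasurable]
  refine (hP.integral_w hX l t).1.mono' (by fun_prop) (.of_forall fun ω => ?_)
  rw [Real.norm_of_nonneg (by positivity)]
  exact Finset.single_le_sum (f := fun m => ‖P.w X μ l t ω m‖ ^ 2) (fun _ _ => by positivity)
    (Finset.mem_univ m)

lemma sum_integral_w (hP : P.IsValid) (hX : X.IsRayleigh μ) (l : Fin L) (t : Fin K) :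
    ∑ m, ∫ ω, ‖P.w X μ l t ω m‖ ^ 2 ∂μ = 1 := by
  rw [← (hP.integral_w hX l t).2, integral_finsetSum]
  exact fun m _ => (memLp_two_iff_integrable_sq_norm (hP.memLp_w hX l t m).1).mp
    (hP.memLp_w hX l t m)

/-- Effective gain of the signal for user `t` at user `k`, in terms of the estimated gain. -/
lemma gain_of_estimated_gain (hP : P.IsValid) (hX : X.IsRayleigh μ) (l : Fin L) (k t : Fin K)
    (hc : MemLp (fun ω => star (P.hhat X l k ω) ⬝ᵥ P.w X μ l t ω) 2 μ) :
    MemLp (fun ω => star (P.h X l k ω) ⬝ᵥ P.w X μ l t ω) 2 μ ∧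
    ∫ ω, star (P.h X l k ω) ⬝ᵥ P.w X μ l t ω ∂μ
      = ∫ ω, star (P.hhat X l k ω) ⬝ᵥ P.w X μ l t ω ∂μ ∧
    ∫ ω, ‖star (P.h X l k ω) ⬝ᵥ P.w X μ l t ω‖ ^ 2 ∂μ = P.β l k - P.γ l k
      + ∫ ω, ‖star (P.hhat X l k ω) ⬝ᵥ P.w X μ l t ω‖ ^ 2 ∂μ := by
  obtain ⟨e, hem, hel, hei, heq⟩ := hP.exists_error hX l k
  obtain ⟨hwhite, hzero⟩ := isWhite_star_of_map_eq hem hel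
  have hlt := hP.γ_lt_β l k
  set σ := √(P.β l k - P.γ l k) with hσ
  set c := fun ω => star (P.hhat X l k ω) ⬝ᵥ P.w X μ l t ω with hcdef
  set v : Fin M → Ω → ℂ := fun m ω => (σ : ℂ) * P.w X μ l t ω m with hv
  have hvm : ∀ m, MemLp (v m) 2 μ := fun m => (hP.memLp_w hX l t m).const_mul _
  -- The error part is white, centered and independent of everything built from the estimates, so it
  -- is orthogonal to `c`. Its power is `β - γ` times the mean power of the precoder, which is `1`.
  have hdec : ∀ ω, star (P.h X l k ω) ⬝ᵥ P.w X μ l t ω = (∑ m, star (e ω m) * v m ω) + c ω := by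
    intro ω
    rw [heq, star_add, add_dotProduct, add_comm, hcdef]
    congr 1
    simp only [dotProduct, hv, Pi.star_apply, Pi.smul_apply, smul_eq_mul, star_mul',
      Complex.star_def, Complex.conj_ofReal]
    exact Finset.sum_congr rfl fun m _ => by ring
  have hind : IndepFun (fun ω m => star (e ω m)) (fun ω => ((fun m => v m ω), c ω)) μ := by
    have hpm := measurable_precoder (m := Fin M) (P.S l) t
    have hw : Measurable fun (H : Fin K → Fin M → ℂ) (m : Fin M) =>
        (((1 / √(∫ ω', ∑ m, ‖P.u X l t ω' m‖ ^ 2 ∂μ) : ℝ) : ℂ) • precoder (P.S l) H t) m :=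
      measurable_pi_lambda _ fun m => by fun_prop
    refine hei.comp (φ := fun (z : Fin M → ℂ) m => star (z m))
      (ψ := fun H : Fin K → Fin M → ℂ =>
        ((fun m => (σ : ℂ) * (((1 / √(∫ ω', ∑ m, ‖P.u X l t ω' m‖ ^ 2 ∂μ) : ℝ) : ℂ) •
          precoder (P.S l) H t) m),
        star (H k) ⬝ᵥ (((1 / √(∫ ω', ∑ m, ‖P.u X l t ω' m‖ ^ 2 ∂μ) : ℝ) : ℂ) •
          precoder (P.S l) H t))) (by fun_prop) ?_
    refine Measurable.prodMk (measurable_pi_lambda _ fun m => ?_) ?_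
    · exact (measurable_pi_iff.mp hw m).const_mul _
    · refine Finset.measurable_fun_sum _ fun m _ => Measurable.mul ?_ (measurable_pi_iff.mp hw m)
      change Measurable fun H : Fin K → Fin M → ℂ => star (H k m)
      fun_prop
  have hind' : IndepFun (fun ω m => star (e ω m)) (fun ω m => v m ω) μ :=
    hind.comp (φ := id) (ψ := Prod.fst) measurable_id measurable_fst
  have hs := hwhite.memLp_sum_mul hvm hind'
  simp_rw [hdec]
  refine ⟨hs.add hc, ?_, ?_⟩
  · rw [integral_add (hs.integrable (by norm_num)) (hc.integrable (by norm_num)),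
      hwhite.integral_sum_mul hzero hvm hind', zero_add]
  · rw [integral_norm_add_sq hs hc (hwhite.integral_sum_mul_mul_star hzero hvm hc hind),
      hwhite.integral_norm_sum_mul_sq hvm hind']
    congr 1
    have h1 : ∀ m, ∫ ω, ‖v m ω‖ ^ 2 ∂μ = σ ^ 2 * ∫ ω, ‖P.w X μ l t ω m‖ ^ 2 ∂μ := fun m => by
      rw [← integral_const_mul]
      refine integral_congr_ae (.of_forall fun ω => ?_)
      simp [hv, mul_pow]
    simp_rw [h1]
    rw [← Finset.mul_sum, hP.sum_integral_w hX l t, mul_one, hσ, Real.sq_sqrt (by linarith)]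

end Params.IsValid

end Gains

/-- For strong `t` this reads off an entry of `Aᴴ A (Aᴴ A)⁻¹ = 1`; for weak `t` the precoder is
orthogonal to all strong estimates. -/
lemma star_dotProduct_precoder {m κ : Type*} [Fintype m] [DecidableEq m] [DecidableEq κ]
    {S : Finset κ} {H : κ → m → ℂ} (hH : LinearIndepOn ℂ H (S : Set κ)) {k : κ} (hk : k ∈ S)
    (t : κ) : star (H k) ⬝ᵥ precoder S H t = if t = k then 1 else 0 := by
  have hS : LinearIndependent ℂ fun i : S => H i := hH
  unfold precoder
  split_ifs with ht htk htk
  · subst htk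
    have hu := (isUnit_iff_isUnit_det _).mp (isUnit_gram hS)
    have h : ((colMatrix fun i : S => H i)ᴴ *ᵥ ((colMatrix (fun i : S => H i) *
        ((colMatrix fun i : S => H i)ᴴ * colMatrix fun i : S => H i)⁻¹) *ᵥ
          Pi.single ⟨t, ht⟩ 1)) = Pi.single ⟨t, ht⟩ 1 := by
      rw [mulVec_mulVec, ← Matrix.mul_assoc, mul_nonsing_inv _ hu, one_mulVec]
    have h2 := congrFun h ⟨t, hk⟩
    rw [Pi.single_eq_same] at h2
    exact h2
  · have hu := (isUnit_iff_isUnit_det _).mp (isUnit_gram hS)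
    have h : ((colMatrix fun i : S => H i)ᴴ *ᵥ ((colMatrix (fun i : S => H i) *
        ((colMatrix fun i : S => H i)ᴴ * colMatrix fun i : S => H i)⁻¹) *ᵥ
          Pi.single ⟨t, ht⟩ 1)) = Pi.single ⟨t, ht⟩ 1 := by
      rw [mulVec_mulVec, ← Matrix.mul_assoc, mul_nonsing_inv _ hu, one_mulVec]
    have h2 := congrFun h ⟨k, hk⟩
    rw [Pi.single_eq_of_ne (fun h => htk (congrArg Subtype.val h).symm)] at h2
    exact h2
  · subst htk; exact absurd hk ht
  · exact star_dotProduct_orthProj_mulVec hS ⟨k, hk⟩ (H t)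

-- First and second moments of the effective gains at one AP.

section GainMoments

variable {L K M τ : ℕ} [NeZero K] {Ω : Type*} [MeasurableSpace Ω] {μ : Measure Ω}
  {P : Params L K M τ} {X : Block L K M τ Ω} [IsProbabilityMeasure μ]

namespace Params.IsValid

/-- The estimated gain at a strong user is almost surely constant, so only the estimation error
fluctuates. -/
lemma gain_of_mem (hP : P.IsValid) (hX : X.IsRayleigh μ) (l : Fin L) (k t : Fin K)
    (hk : k ∈ P.S l) :
    MemLp (fun ω => star (P.h X l k ω) ⬝ᵥ P.w X μ l t ω) 2 μ ∧
    ∫ ω, star (P.h X l k ω) ⬝ᵥ P.w X μ l t ω ∂μ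
      = ((if t = k then √(P.γ l k * (M - (P.S l).card)) else 0 : ℝ) : ℂ) ∧
    ∫ ω, ‖star (P.h X l k ω) ⬝ᵥ P.w X μ l t ω‖ ^ 2 ∂μ = P.β l k - P.γ l k
      + if t = k then P.γ l k * (M - (P.S l).card) else 0 := by
  have hγ := hP.γ_pos l k
  have hN := hP.sub_card_pos l
  set r : ℝ := if t = k then √(P.γ l k * (M - (P.S l).card)) else 0 with hr
  have hae : (fun ω => star (P.hhat X l k ω) ⬝ᵥ P.w X μ l t ω) =ᵐ[μ] fun _ => (r : ℂ) := by
    filter_upwards [(hP.isGaussianEstimates hX l).ae_linearIndepOn (P.S l) (hP.card_lt l)]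
      with ω hω
    have h1 : star (P.hhat X l k ω) ⬝ᵥ P.u X l t ω = if t = k then 1 else 0 :=
      star_dotProduct_precoder hω hk t
    rw [hP.w_eq hX, dotProduct_smul, h1, hr]
    by_cases htk : t = k
    · subst htk
      simp [hk]
    · simp [htk]
  have hc : MemLp (fun ω => star (P.hhat X l k ω) ⬝ᵥ P.w X μ l t ω) 2 μ :=
    (memLp_congr_ae hae).mpr (memLp_const _)
  obtain ⟨h1, h2, h3⟩ := hP.gain_of_estimated_gain hX l k t hc
  refine ⟨h1, ?_, ?_⟩
  · rw [h2, integral_congr_ae hae]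
    simp
  · rw [h3]
    have hae2 : (fun ω => ‖star (P.hhat X l k ω) ⬝ᵥ P.w X μ l t ω‖ ^ 2) =ᵐ[μ] fun _ => r ^ 2 := by
      filter_upwards [hae] with ω hω
      rw [hω, Complex.norm_real, Real.norm_eq_abs, sq_abs]
    rw [integral_congr_ae hae2, hr]
    split_ifs
    · simp [Real.sq_sqrt (mul_pos hγ hN).le]
    · simp

/-- The estimated gain is `q / √p`, where `q` is the projected power of the estimate and `p` its
mean. Its second moment is `p + γ`, and the `γ` cancels against the error power `β - γ`. -/
lemma gain_self_of_notMem (hP : P.IsValid) (hX : X.IsRayleigh μ) (l : Fin L) (k : Fin K)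
    (hk : k ∉ P.S l) :
    MemLp (fun ω => star (P.h X l k ω) ⬝ᵥ P.w X μ l k ω) 2 μ ∧
    ∫ ω, star (P.h X l k ω) ⬝ᵥ P.w X μ l k ω ∂μ = (√(P.γ l k * (M - (P.S l).card)) : ℂ) ∧
    ∫ ω, ‖star (P.h X l k ω) ⬝ᵥ P.w X μ l k ω‖ ^ 2 ∂μ
      = P.β l k + P.γ l k * (M - (P.S l).card) := by
  have hγ := hP.γ_pos l k
  have hN := hP.sub_card_pos l
  obtain ⟨n, hn, hnN⟩ := hP.exists_rank l
  have hE := hP.isGaussianEstimates hX l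
  set p : ℝ := P.γ l k * (M - (P.S l).card) with hp
  have hp0 : 0 < p := mul_pos hγ hN
  set q : Ω → ℝ := fun ω => quadForm (orthProj fun i : P.S l => P.hhat X l i ω) (P.hhat X l k ω)
    with hq
  have hqm : Measurable q := hE.measurable_quadForm (P.S l) k
  have hc : ∀ ω, star (P.hhat X l k ω) ⬝ᵥ P.w X μ l k ω = ((1 / √p * q ω : ℝ) : ℂ) := fun ω => by
    have h1 : P.u X l k ω
        = orthProj (fun i : P.S l => P.hhat X l i ω) *ᵥ P.hhat X l k ω := by
      rw [P.u_eq_precoder]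
      simp [precoder, hk]
    rw [hP.w_eq hX, if_neg hk, dotProduct_smul, h1, ← ofReal_quadForm (orthProj_isHermitian _)]
    push_cast
    rfl
  have hq1 : ∫ ω, q ω ∂μ = p := by
    obtain ⟨-, h⟩ := hP.integral_u hX l k
    rw [if_neg hk] at h
    rw [hp, ← h]
    refine integral_congr_ae ?_
    filter_upwards [hE.ae_linearIndepOn (P.S l) (hP.card_lt l)] with ω hω
    simp only [hq]
    rw [← sum_norm_sq_mulVec (orthProj_isHermitian _)
      (orthProj_mul_self (H := fun i : P.S l => P.hhat X l i ω) hω), P.u_eq_precoder]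
    simp [precoder, hk]
  have hq2' : ∫⁻ ω, ENNReal.ofReal (q ω ^ 2) ∂μ
      = ENNReal.ofReal (p * (p + P.γ l k)) := by
    have h := hE.lintegral_quadForm_sq hn hk
    have h4 : √(P.γ l k) ^ 4 = P.γ l k ^ 2 := by
      rw [show (4 : ℕ) = 2 * 2 from rfl, pow_mul, Real.sq_sqrt hγ.le]
    rw [h4] at h
    rw [hq, h, hp, ← hnN]
    congr 1
    ring
  have hq2i : Integrable (fun ω => q ω ^ 2) μ := by
    refine ⟨by fun_prop, ?_⟩
    rw [hasFiniteIntegral_iff_ofReal (.of_forall fun ω => sq_nonneg _), hq2']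
    exact ENNReal.ofReal_lt_top
  have hq2 : ∫ ω, q ω ^ 2 ∂μ = p * (p + P.γ l k) := by
    rw [integral_eq_lintegral_of_nonneg_ae (.of_forall fun ω => sq_nonneg _) (by fun_prop), hq2',
      ENNReal.toReal_ofReal (by positivity)]
  have hcn : ∀ ω, ‖((1 / √p * q ω : ℝ) : ℂ)‖ ^ 2 = p⁻¹ * q ω ^ 2 := fun ω => by
    rw [Complex.norm_real, Real.norm_eq_abs, sq_abs, mul_pow, div_pow, Real.sq_sqrt hp0.le]
    simp
  have hcm : MemLp (fun ω => star (P.hhat X l k ω) ⬝ᵥ P.w X μ l k ω) 2 μ := by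
    simp_rw [hc]
    rw [memLp_two_iff_integrable_sq_norm (by fun_prop)]
    simp_rw [hcn]
    exact hq2i.const_mul _
  obtain ⟨h1, h2, h3⟩ := hP.gain_of_estimated_gain hX l k k hcm
  refine ⟨h1, ?_, ?_⟩
  · rw [h2]
    simp_rw [hc]
    rw [integral_complex_ofReal, integral_const_mul, hq1]
    congr 1
    rw [one_div, inv_mul_eq_div, Real.div_sqrt]
  · rw [h3]
    simp_rw [hc, hcn]
    rw [integral_const_mul, hq2, inv_mul_cancel_left₀ hp0.ne']
    ring

/-- The precoder of `t` does not use the estimate of the weak user `k`, hence is independent of the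
true channel of `k`. No splitting into estimate and error is needed here. -/
lemma gain_of_notMem_of_ne (hP : P.IsValid) (hX : X.IsRayleigh μ) (l : Fin L) (k t : Fin K)
    (hk : k ∉ P.S l) (htk : t ≠ k) :
    MemLp (fun ω => star (P.h X l k ω) ⬝ᵥ P.w X μ l t ω) 2 μ ∧
    ∫ ω, star (P.h X l k ω) ⬝ᵥ P.w X μ l t ω ∂μ = 0 ∧
    ∫ ω, ‖star (P.h X l k ω) ⬝ᵥ P.w X μ l t ω‖ ^ 2 ∂μ = P.β l k := by
  have hb := hP.β_pos l k
  obtain ⟨hgm, hgl⟩ := hX.map_g l k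
  obtain ⟨hwhite, hzero⟩ := isWhite_star_of_map_eq hgm hgl
  set v : Fin M → Ω → ℂ := fun m ω => (√(P.β l k) : ℂ) * P.w X μ l t ω m with hv
  have hvm : ∀ m, MemLp (v m) 2 μ := fun m => (hP.memLp_w hX l t m).const_mul _
  have hdec : ∀ ω, star (P.h X l k ω) ⬝ᵥ P.w X μ l t ω = ∑ m, star (X.g l k m ω) * v m ω := by
    intro ω
    simp only [dotProduct, hv, Params.h, Pi.star_apply, star_mul', Complex.star_def,
      Complex.conj_ofReal]
    exact Finset.sum_congr rfl fun m _ => by ring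
  have hind : IndepFun (fun ω m => star (X.g l k m ω)) (fun ω m => v m ω) μ := by
    set d : ℂ := ((1 / √(∫ ω', ∑ m, ‖P.u X l t ω' m‖ ^ 2 ∂μ) : ℝ) : ℂ) with hd
    -- The slot of `k` is filled with `0`; by `precoder_congr` the value is irrelevant.
    set E : ({j : Fin K // j ≠ k} → Fin M → ℂ) → Fin K → Fin M → ℂ :=
      fun H j => if h : j ≠ k then H ⟨j, h⟩ else 0 with hE
    have hEm : Measurable E := by
      refine measurable_pi_lambda _ fun j => ?_
      by_cases h : j ≠ k
      · simp only [hE, dif_pos h]; fun_prop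
      · simp only [hE, dif_neg h]; fun_prop
    have hpm := (measurable_precoder (m := Fin M) (P.S l) t).comp hEm
    have hψ : Measurable fun (H : {j : Fin K // j ≠ k} → Fin M → ℂ) (m : Fin M) =>
        (√(P.β l k) : ℂ) * (d * precoder (P.S l) (E H) t m) :=
      measurable_pi_lambda _ fun m => ((measurable_pi_iff.mp hpm m).const_mul _).const_mul _
    have hφ : Measurable fun (z : Fin M → ℂ) m => star ((√(P.β l k) : ℂ)⁻¹ * z m) := by fun_prop
    have h := (hP.indepFun_h_hhat hX l k).comp hφ hψ
    have hb0 : (√(P.β l k) : ℂ) ≠ 0 := by exact_mod_cast (Real.sqrt_pos.mpr hb).ne'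
    have e1 : (fun (z : Fin M → ℂ) m => star ((√(P.β l k) : ℂ)⁻¹ * z m)) ∘ P.h X l k
        = fun ω m => star (X.g l k m ω) := by
      funext ω m
      simp only [Function.comp_apply, Params.h]
      rw [inv_mul_cancel_left₀ hb0]
    have e2 : (fun (H : {j : Fin K // j ≠ k} → Fin M → ℂ) (m : Fin M) =>
        (√(P.β l k) : ℂ) * (d * precoder (P.S l) (E H) t m))
          ∘ (fun ω (j : {j : Fin K // j ≠ k}) => P.hhat X l j ω) = fun ω m => v m ω := by
      funext ω m
      have hE' : ∀ j, j ≠ k → E (fun j : {j : Fin K // j ≠ k} => P.hhat X l j ω) j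
          = P.hhat X l j ω := fun j hj => by simp only [hE, dif_pos hj]
      have hpr : precoder (P.S l) (E fun j : {j : Fin K // j ≠ k} => P.hhat X l j ω) t
          = P.u X l t ω := by
        rw [P.u_eq_precoder, Function.comp_apply]
        exact precoder_congr (fun i hi => hE' i fun h => hk (h ▸ hi)) (hE' t htk)
      simp only [Function.comp_apply, hpr, hv, Params.w, Pi.smul_apply, smul_eq_mul, hd]
    rw [e1, e2] at h
    exact h
  simp_rw [hdec]
  refine ⟨hwhite.memLp_sum_mul hvm hind, hwhite.integral_sum_mul hzero hvm hind, ?_⟩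
  rw [hwhite.integral_norm_sum_mul_sq hvm hind]
  have h1 : ∀ m, ∫ ω, ‖v m ω‖ ^ 2 ∂μ = P.β l k * ∫ ω, ‖P.w X μ l t ω m‖ ^ 2 ∂μ := fun m => by
    rw [← integral_const_mul]
    refine integral_congr_ae (.of_forall fun ω => ?_)
    simp only [hv, norm_mul, mul_pow, Complex.norm_real, Real.norm_eq_abs, sq_abs,
      Real.sq_sqrt hb.le]
  simp_rw [h1]
  rw [← Finset.mul_sum, hP.sum_integral_w hX l t, mul_one]

/-- First and second moment of the effective gain of the signal for user `t` at user `k`. -/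
lemma gain (hP : P.IsValid) (hX : X.IsRayleigh μ) (l : Fin L) (k t : Fin K) :
    MemLp (fun ω => star (P.h X l k ω) ⬝ᵥ P.w X μ l t ω) 2 μ ∧
    ∫ ω, star (P.h X l k ω) ⬝ᵥ P.w X μ l t ω ∂μ
      = ((if t = k then √(P.γ l k * (M - (P.S l).card)) else 0 : ℝ) : ℂ) ∧
    ∫ ω, ‖star (P.h X l k ω) ⬝ᵥ P.w X μ l t ω‖ ^ 2 ∂μ = P.β l k - P.δ l k * P.γ l k
      + if t = k then P.γ l k * (M - (P.S l).card) else 0 := by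
  by_cases hk : k ∈ P.S l
  · have h := hP.gain_of_mem hX l k t hk
    simpa only [Params.δ, if_pos hk, one_mul] using h
  · simp only [Params.δ, if_neg hk, zero_mul, sub_zero]
    by_cases htk : t = k
    · subst htk
      simpa using hP.gain_self_of_notMem hX l t hk
    · simpa [htk] using hP.gain_of_notMem_of_ne hX l k t hk htk

end Params.IsValid

end GainMoments

-- Independence of distinct APs and the closed form of the SINR.

section Aggregate

variable {L K M τ : ℕ} {Ω : Type*}

/-- Index set of the scalar random variables of a block. -/
abbrev BlockIndex (L K M τ : ℕ) :=
  (Fin L × Fin K × Fin M) ⊕ (Fin L × Fin M) ⊕ (Fin L × Fin M × Fin τ)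

/-- The AP to which a scalar random variable belongs. -/
def apIndex : BlockIndex L K M τ → Fin L
  | .inl (l, _, _) => l
  | .inr (.inl (l, _)) => l
  | .inr (.inr (l, _, _)) => l

/-- The block of coordinate functions. -/
def coordBlock (L K M τ : ℕ) : Block L K M τ (BlockIndex L K M τ → ℂ) where
  g l k m z := z (.inl (l, k, m))
  gE l m z := z (.inr (.inl (l, m)))
  N l m i z := z (.inr (.inr (l, m, i)))

lemma coordBlock_family (i : BlockIndex L K M τ) :
    (coordBlock L K M τ).family i = fun z => z i := by
  rcases i with _ | _ | _ <;> rfl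

/-- With this, measurability statements proved for Rayleigh blocks apply to precoders viewed as
functions on the space of realizations. -/
lemma coordBlock_isRayleigh :
    (coordBlock L K M τ).IsRayleigh (stdComplexGaussianVec (BlockIndex L K M τ)) where
  measurable i := by rw [coordBlock_family]; fun_prop
  law i := by
    rw [coordBlock_family]
    exact (measurePreserving_eval (fun _ => stdComplexGaussian) i).map_eq
  indep := by
    have h := iIndepFun_pi (μ := fun _ : BlockIndex L K M τ => stdComplexGaussian)
      (X := fun _ z => z) (fun _ => by fun_prop)
    have h2 : (coordBlock L K M τ).family = fun i z => z i := funext coordBlock_family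
    rw [h2]
    exact h

/-- Restriction of a realization to the random variables of AP `l`. -/
def maskAP (l : Fin L) (z : BlockIndex L K M τ → ℂ) : BlockIndex L K M τ → ℂ :=
  fun i => if apIndex i = l then z i else 0

lemma h_maskAP (P : Params L K M τ) (l : Fin L) (k : Fin K) (z : BlockIndex L K M τ → ℂ) :
    P.h (coordBlock L K M τ) l k (maskAP l z) = P.h (coordBlock L K M τ) l k z := by
  funext m
  simp [Params.h, coordBlock, maskAP, apIndex]

variable [NeZero K]

lemma hhat_maskAP (P : Params L K M τ) (l : Fin L) (k : Fin K) (z : BlockIndex L K M τ → ℂ) :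
    P.hhat (coordBlock L K M τ) l k (maskAP l z) = P.hhat (coordBlock L K M τ) l k z := by
  have hE : P.hE (coordBlock L K M τ) l (maskAP l z) = P.hE (coordBlock L K M τ) l z := by
    funext m
    simp [Params.hE, coordBlock, maskAP, apIndex]
  have hN : ∀ m i, (coordBlock L K M τ).N l m i (maskAP l z) = (coordBlock L K M τ).N l m i z := by
    intro m i
    simp [coordBlock, maskAP, apIndex]
  have hY : P.Y (coordBlock L K M τ) l (maskAP l z) = P.Y (coordBlock L K M τ) l z := by
    unfold Params.Y
    simp_rw [h_maskAP, hE, hN]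
  unfold Params.hhat
  rw [hY]

variable [MeasurableSpace Ω] {μ : Measure Ω} {P : Params L K M τ} {X : Block L K M τ Ω}

/-- The effective gain at user `k` of the signal for user `t` sent by AP `l`, as a function of the
scalar random variables of the block. -/
def gainFun (P : Params L K M τ) (X : Block L K M τ Ω) (μ : Measure Ω) (l : Fin L) (k t : Fin K)
    (z : BlockIndex L K M τ → ℂ) : ℂ :=
  star (P.h (coordBlock L K M τ) l k z) ⬝ᵥ
    (((1 / √(∫ ω', ∑ m, ‖P.u X l t ω' m‖ ^ 2 ∂μ) : ℝ) : ℂ) • P.u (coordBlock L K M τ) l t z)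

/-- The identity is definitional because `gainFun` takes its normalization constant from `X` and `μ`
rather than from the coordinate block. -/
lemma gainFun_family (l : Fin L) (k t : Fin K) (ω : Ω) :
    gainFun P X μ l k t (fun i => X.family i ω) = star (P.h X l k ω) ⬝ᵥ P.w X μ l t ω := rfl

lemma gainFun_maskAP (l : Fin L) (k t : Fin K) (z : BlockIndex L K M τ → ℂ) :
    gainFun P X μ l k t (maskAP l z) = gainFun P X μ l k t z := by
  have hu : P.u (coordBlock L K M τ) l t (maskAP l z) = P.u (coordBlock L K M τ) l t z := by
    rw [P.u_eq_precoder, Function.comp_apply, Function.comp_apply]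
    simp_rw [hhat_maskAP]
  unfold gainFun
  rw [h_maskAP, hu]

lemma measurable_gainFun (hP : P.IsValid) (l : Fin L) (k t : Fin K) :
    Measurable (gainFun P X μ l k t) := by
  have hu := hP.measurable_u coordBlock_isRayleigh l t
  unfold gainFun
  refine Finset.measurable_fun_sum _ fun m _ => Measurable.mul ?_ ?_
  · change Measurable fun z : BlockIndex L K M τ → ℂ => star ((√(P.β l k) : ℂ) * z (.inl (l, k, m)))
    fun_prop
  · fun_prop

/-- By `gainFun_maskAP` each gain depends only on the sources of its own AP, and the sources of
distinct APs are disjoint subfamilies of an independent family. -/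
lemma indepFun_gain (hP : P.IsValid) (hX : X.IsRayleigh μ) {l l' : Fin L} (hl : l ≠ l')
    (k t : Fin K) :
    IndepFun (fun ω => star (P.h X l k ω) ⬝ᵥ P.w X μ l t ω)
      (fun ω => star (P.h X l' k ω) ⬝ᵥ P.w X μ l' t ω) μ := by
  classical
  set T : Fin L → Finset (BlockIndex L K M τ) := fun l => Finset.univ.filter fun i => apIndex i = l
    with hT
  have hdisj : Disjoint (T l) (T l') := by
    rw [Finset.disjoint_left]
    intro i hi hi'
    simp only [hT, Finset.mem_filter, Finset.mem_univ, true_and] at hi hi'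
    exact hl (hi.symm.trans hi')
  have h1 := hX.indep.indepFun_finset (T l) (T l') hdisj hX.measurable
  have hext : ∀ l, Measurable fun (z : T l → ℂ) (i : BlockIndex L K M τ) =>
      if h : i ∈ T l then z ⟨i, h⟩ else 0 := fun l => by
    refine measurable_pi_lambda _ fun i => ?_
    by_cases h : i ∈ T l
    · simp only [dif_pos h]; fun_prop
    · simp only [dif_neg h]; fun_prop
  have h2 := h1.comp ((measurable_gainFun (X := X) (μ := μ) hP l k t).comp (hext l))
    ((measurable_gainFun (X := X) (μ := μ) hP l' k t).comp (hext l'))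
  have h3 : ∀ l, (gainFun P X μ l k t ∘ fun (z : T l → ℂ) (i : BlockIndex L K M τ) =>
      if h : i ∈ T l then z ⟨i, h⟩ else 0) ∘ (fun ω (i : T l) => X.family i ω)
        = fun ω => star (P.h X l k ω) ⬝ᵥ P.w X μ l t ω := fun l => by
    funext ω
    rw [← gainFun_family, ← gainFun_maskAP]
    simp only [Function.comp_apply]
    congr 1
    funext i
    simp [hT, maskAP]
  rw [h3, h3] at h2
  exact h2

variable [IsProbabilityMeasure μ]

lemma integral_norm_sub_integral_sq {a : Ω → ℂ} (ha : MemLp a 2 μ) :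
    ∫ ω, ‖a ω - ∫ ω', a ω' ∂μ‖ ^ 2 ∂μ = (∫ ω, ‖a ω‖ ^ 2 ∂μ) - ‖∫ ω, a ω ∂μ‖ ^ 2 := by
  have hi := ha.integrable (by norm_num)
  have h := integral_norm_add_sq (f := fun ω => a ω - ∫ ω', a ω' ∂μ)
    (g := fun _ => ∫ ω', a ω' ∂μ) (ha.sub (memLp_const _)) (memLp_const _) (by
      rw [integral_mul_const, integral_sub hi (integrable_const _)]
      simp)
  simp only [sub_add_cancel, integral_const, probReal_univ, one_smul] at h
  linarith

namespace Params.IsValid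

/-- Mean power of the fluctuation of the overall gain at user `k` of the signal for user `t`. -/
lemma integral_norm_sum_gain_sub_sq (hP : P.IsValid) (hX : X.IsRayleigh μ) (k t : Fin K) :
    ∫ ω, ‖∑ l, ((√(P.ρ l t) : ℂ) * (star (P.h X l k ω) ⬝ᵥ P.w X μ l t ω)
      - (√(P.ρ l t) : ℂ) * ∫ ω', star (P.h X l k ω') ⬝ᵥ P.w X μ l t ω' ∂μ)‖ ^ 2 ∂μ
      = ∑ l, P.ρ l t * (P.β l k - P.δ l k * P.γ l k) := by
  set a : Fin L → Ω → ℂ := fun l ω => star (P.h X l k ω) ⬝ᵥ P.w X μ l t ω with ha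
  have ham : ∀ l, MemLp (a l) 2 μ := fun l => (hP.gain hX l k t).1
  have hbm : ∀ l, MemLp (fun ω => (√(P.ρ l t) : ℂ) * a l ω
      - (√(P.ρ l t) : ℂ) * ∫ ω', a l ω' ∂μ) 2 μ := fun l =>
    ((ham l).const_mul _).sub (memLp_const _)
  have hb0 : ∀ l, ∫ ω, ((√(P.ρ l t) : ℂ) * a l ω - (√(P.ρ l t) : ℂ) * ∫ ω', a l ω' ∂μ) ∂μ = 0 := by
    intro l
    rw [integral_sub (((ham l).integrable (by norm_num)).const_mul _) (integrable_const _),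
      integral_const_mul]
    simp
  rw [integral_norm_sum_sq _ fun l _ => hbm l]
  · refine Finset.sum_congr rfl fun l _ => ?_
    have h1 : ∀ ω, ‖(√(P.ρ l t) : ℂ) * a l ω - (√(P.ρ l t) : ℂ) * ∫ ω', a l ω' ∂μ‖ ^ 2
        = P.ρ l t * ‖a l ω - ∫ ω', a l ω' ∂μ‖ ^ 2 := fun ω => by
      rw [← mul_sub, norm_mul, mul_pow, Complex.norm_real, Real.norm_eq_abs, sq_abs,
        Real.sq_sqrt (hP.ρ_nonneg l t)]
    simp_rw [h1]
    rw [integral_const_mul, integral_norm_sub_integral_sq (ham l)]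
    obtain ⟨-, h2, h3⟩ := hP.gain hX l k t
    rw [h2, h3, Complex.norm_real, Real.norm_eq_abs, sq_abs]
    congr 1
    split_ifs
    · rw [Real.sq_sqrt (mul_pos (hP.γ_pos l k) (hP.sub_card_pos l)).le]; ring
    · ring
  -- Centered gains of distinct APs are independent, hence orthogonal.
  · intro l _ l' _ hl
    have hi := (indepFun_gain hP hX hl k t).comp
      (φ := fun x => (√(P.ρ l t) : ℂ) * x - (√(P.ρ l t) : ℂ) * ∫ ω', a l ω' ∂μ)
      (ψ := fun x => star ((√(P.ρ l' t) : ℂ) * x - (√(P.ρ l' t) : ℂ) * ∫ ω', a l' ω' ∂μ))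
      (by fun_prop) (by fun_prop)
    have h := hi.integral_fun_mul_eq_mul_integral (hbm l).1 (hbm l').star.1
    refine h.trans ?_
    rw [show (∫ ω, ((fun x => (√(P.ρ l t) : ℂ) * x - (√(P.ρ l t) : ℂ) * ∫ ω', a l ω' ∂μ) ∘ a l) ω
      ∂μ) = 0 from hb0 l, zero_mul]

lemma memLp_PU (hP : P.IsValid) (hX : X.IsRayleigh μ) (k : Fin K) :
    MemLp (P.PU X μ k) 2 μ :=
  memLp_finsetSum _ fun l _ => ((hP.gain hX l k k).1.const_mul _).sub (memLp_const _)

lemma memLp_UI (hP : P.IsValid) (hX : X.IsRayleigh μ) (k t : Fin K) :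
    MemLp (P.UI X μ k t) 2 μ :=
  memLp_finsetSum _ fun l _ => (hP.gain hX l k t).1.const_mul _

lemma integral_PU (hP : P.IsValid) (hX : X.IsRayleigh μ) (k : Fin K) :
    ∫ ω, ‖P.PU X μ k ω‖ ^ 2 ∂μ = ∑ l, P.ρ l k * (P.β l k - P.δ l k * P.γ l k) :=
  hP.integral_norm_sum_gain_sub_sq hX k k

lemma integral_UI_of_ne (hP : P.IsValid) (hX : X.IsRayleigh μ) {k t : Fin K} (htk : t ≠ k) :
    ∫ ω, ‖P.UI X μ k t ω‖ ^ 2 ∂μ = ∑ l, P.ρ l t * (P.β l k - P.δ l k * P.γ l k) := by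
  rw [← hP.integral_norm_sum_gain_sub_sq hX k t]
  refine integral_congr_ae (.of_forall fun ω => ?_)
  simp only [Params.UI, fun l => (hP.gain hX l k t).2.1, if_neg htk, Complex.ofReal_zero, mul_zero,
    sub_zero]

lemma CP_eq (hP : P.IsValid) (hX : X.IsRayleigh μ) (k : Fin K) :
    P.CP X μ k = ((∑ l, √(((M : ℝ) - (P.S l).card) * P.ρ l k * P.γ l k) : ℝ) : ℂ) := by
  unfold Params.CP
  rw [Complex.ofReal_sum]
  refine Finset.sum_congr rfl fun l _ => ?_
  rw [(hP.gain hX l k k).2.1, if_pos rfl, ← Complex.ofReal_mul, ← Real.sqrt_mul (hP.ρ_nonneg l k)]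
  congr 2
  ring

/-- The gain uncertainty supplies exactly the summand `t = k` missing from the interference, which
completes the double sum. -/
lemma SINR_eq (hP : P.IsValid) (hX : X.IsRayleigh μ) (k : Fin K) :
    P.SINR X μ k = (∑ l, √(((M : ℝ) - (P.S l).card) * P.ρ l k * P.γ l k)) ^ 2 /
        (∑ t, ∑ l, P.ρ l t * (P.β l k - P.δ l k * P.γ l k) + 1) := by
  unfold Params.SINR
  rw [hP.CP_eq hX, Complex.norm_real, Real.norm_eq_abs, sq_abs, hP.integral_PU hX,
    Finset.sum_congr rfl fun t ht => hP.integral_UI_of_ne hX (Finset.ne_of_mem_erase ht),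
    Finset.add_sum_erase _ (fun t => ∑ l, P.ρ l t * (P.β l k - P.δ l k * P.γ l k))
      (Finset.mem_univ k)]

end Params.IsValid

end Aggregate

-- Variational lower bound on mutual information.

section MutualInformation

/-- Lower bound on the Kullback-Leibler divergence by a test function. -/
lemma ofReal_integral_le_klDiv {α : Type*} [MeasurableSpace α] {μ ν : Measure α}
    [IsProbabilityMeasure μ] [IsProbabilityMeasure ν] {f : α → ℝ} (hf : Integrable f μ)
    (hν : Integrable (fun x => Real.exp (f x)) ν) (h1 : ∫ x, Real.exp (f x) ∂ν = 1) :
    ENNReal.ofReal (∫ x, f x ∂μ) ≤ InformationTheory.klDiv μ ν := by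
  by_cases htop : InformationTheory.klDiv μ ν = ∞
  · rw [htop]; exact le_top
  obtain ⟨hac, hllr⟩ := InformationTheory.klDiv_ne_top_iff.mp htop
  -- The divergence of `μ` from the tilted measure is nonnegative, and it differs from that of `μ`
  -- from `ν` by the mean of `f`, as the normalizing constant is `1`.
  have : IsProbabilityMeasure (ν.tilted f) := isProbabilityMeasure_tilted hν
  have hac' : μ ≪ ν.tilted f := hac.trans (absolutelyContinuous_tilted hν)
  have h2 := InformationTheory.integral_llr_add_sub_measure_univ_nonneg hac'
    (integrable_llr_tilted_right hac hf hllr hν)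
  rw [integral_llr_tilted_right hac hf hν hllr, h1] at h2
  rw [InformationTheory.klDiv_of_ac_of_integrable hac hllr]
  refine ENNReal.ofReal_le_ofReal ?_
  simp only [Real.log_one, probReal_univ] at h2 ⊢
  linarith

/-- The integrand is the density of `CN(b, v)` relative to `CN(0, 1)`. -/
lemma lintegral_exp_ratio_stdComplexGaussian (b : ℂ) {v : ℝ} (hv : 0 < v) :
    ∫⁻ s, ENNReal.ofReal (Real.exp (‖s‖ ^ 2 - ‖s - b‖ ^ 2 / v - Real.log v)) ∂stdComplexGaussian
      = 1 := by
  rw [lintegral_stdComplexGaussian (by fun_prop)]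
  have h : ∀ s : ℂ, ENNReal.ofReal (Real.pi⁻¹ * Real.exp (-‖s‖ ^ 2))
        * ENNReal.ofReal (Real.exp (‖s‖ ^ 2 - ‖s - b‖ ^ 2 / v - Real.log v))
      = ENNReal.ofReal (Real.pi⁻¹ * v⁻¹) * ENNReal.ofReal (Real.exp (-v⁻¹ * ‖s - b‖ ^ 2)) := by
    intro s
    rw [← ENNReal.ofReal_mul (by positivity), ← ENNReal.ofReal_mul (by positivity)]
    congr 1
    rw [mul_assoc, ← Real.exp_add, mul_assoc]
    congr 1
    rw [show -‖s‖ ^ 2 + (‖s‖ ^ 2 - ‖s - b‖ ^ 2 / v - Real.log v)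
      = -Real.log v + -v⁻¹ * ‖s - b‖ ^ 2 by ring, Real.exp_add, Real.exp_neg, Real.exp_log hv]
  simp_rw [h]
  rw [lintegral_const_mul _ (by fun_prop),
    lintegral_sub_right_eq_self (fun s : ℂ => ENNReal.ofReal (Real.exp (-v⁻¹ * ‖s‖ ^ 2))) b]
  have h2 := lintegral_norm_pow_mul_exp 0 (inv_pos.mpr hv)
  simp only [mul_zero, pow_zero, one_mul, Nat.factorial_zero, Nat.cast_one, zero_add, pow_one,
    mul_one] at h2
  rw [h2, ← ENNReal.ofReal_mul (by positivity)]
  rw [div_inv_eq_mul, show Real.pi⁻¹ * v⁻¹ * (Real.pi * v) = 1 by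
    have := Real.pi_ne_zero
    field_simp, ENNReal.ofReal_one]

/-- Gaussian input: the mutual information is at least that of the Gaussian channel with the same
first and second moments. -/
lemma ofReal_log_le_klDiv {Ω : Type*} [MeasurableSpace Ω] {μ : Measure Ω} [IsProbabilityMeasure μ]
    {s z : Ω → ℂ} (hs : Measurable s) (hz : Measurable z) (hsl : μ.map s = stdComplexGaussian)
    (hz2 : MemLp z 2 μ) {A : ℂ} (hA : ∫ ω, z ω * star (s ω) ∂μ = A) {D : ℝ} (hD : 0 < D)
    (hE : ∫ ω, ‖z ω‖ ^ 2 ∂μ = ‖A‖ ^ 2 + D) :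
    ENNReal.ofReal (Real.log (1 + ‖A‖ ^ 2 / D)) ≤
      InformationTheory.klDiv (μ.map fun ω => (s ω, z ω)) ((μ.map s).prod (μ.map z)) := by
  have hs2 : MemLp s 2 μ := by
    have h := memLp_id_stdComplexGaussian
    rw [← hsl, memLp_map_measure_iff (by fun_prop) hs.aemeasurable] at h
    exact h
  have hsp : ∫ ω, ‖s ω‖ ^ 2 ∂μ = 1 := by
    rw [← integral_norm_sq_stdComplexGaussian, ← hsl,
      integral_map hs.aemeasurable (by fun_prop)]
  set Q : ℝ := ‖A‖ ^ 2 + D with hQ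
  have hQ0 : 0 < Q := by positivity
  -- Here `a` is the coefficient of the linear MMSE estimate of `s` from `z` and `v` is its mean
  -- squared error. The test function `f` is the log-density ratio of `CN(a z, v)` to `CN(0, 1)` at
  -- `s`.
  set v : ℝ := D / Q with hv
  have hv0 : 0 < v := by positivity
  set a : ℂ := star A / Q with ha
  set f : ℂ × ℂ → ℝ := fun p => ‖p.1‖ ^ 2 - ‖p.1 - a * p.2‖ ^ 2 / v - Real.log v with hf
  have hfm : Measurable f := by fun_prop
  have : IsProbabilityMeasure (μ.map fun ω => (s ω, z ω)) :=
    Measure.isProbabilityMeasure_map (by fun_prop)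
  have : IsProbabilityMeasure (μ.map s) := Measure.isProbabilityMeasure_map (by fun_prop)
  have : IsProbabilityMeasure (μ.map z) := Measure.isProbabilityMeasure_map (by fun_prop)
  -- Integrating over `s` first gives `1` for every value of `z`, so nothing about the law of `z`
  -- enters.
  have hexp : ∫⁻ p, ENNReal.ofReal (Real.exp (f p)) ∂((μ.map s).prod (μ.map z)) = 1 := by
    rw [lintegral_prod_symm' _ (by fun_prop), hsl]
    simp_rw [hf, fun y : ℂ => lintegral_exp_ratio_stdComplexGaussian (a * y) hv0]
    simp
  have hi : Integrable (fun p => Real.exp (f p)) ((μ.map s).prod (μ.map z)) := by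
    refine ⟨by fun_prop, ?_⟩
    rw [hasFiniteIntegral_iff_ofReal (.of_forall fun p => (Real.exp_pos _).le), hexp]
    exact ENNReal.one_lt_top
  have hone : ∫ p, Real.exp (f p) ∂((μ.map s).prod (μ.map z)) = 1 := by
    rw [integral_eq_lintegral_of_nonneg_ae (.of_forall fun p => (Real.exp_pos _).le) (by fun_prop),
      hexp, ENNReal.toReal_one]
  have hsi := (memLp_two_iff_integrable_sq_norm hs2.1).mp hs2
  have hzi := (memLp_two_iff_integrable_sq_norm hz2.1).mp hz2
  have hzs := integrable_mul_star hz2 hs2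
  have hexpand : ∀ ω, ‖s ω - a * z ω‖ ^ 2
      = ‖s ω‖ ^ 2 + ‖a‖ ^ 2 * ‖z ω‖ ^ 2 - 2 * (a * (z ω * star (s ω))).re := by
    intro ω
    simp only [Complex.sq_norm, Complex.normSq_apply, Complex.star_def, Complex.mul_re,
      Complex.mul_im, Complex.sub_re, Complex.sub_im, Complex.conj_re, Complex.conj_im]
    ring
  have hre : Integrable (fun ω => (a * (z ω * star (s ω))).re) μ := (hzs.const_mul a).re
  have herr : ∫ ω, ‖s ω - a * z ω‖ ^ 2 ∂μ = v := by
    simp_rw [hexpand]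
    have hadd : Integrable (fun ω => ‖s ω‖ ^ 2 + ‖a‖ ^ 2 * ‖z ω‖ ^ 2) μ :=
      hsi.add (hzi.const_mul _)
    rw [integral_sub hadd (hre.const_mul 2),
      integral_add hsi (hzi.const_mul _), integral_const_mul, integral_const_mul, hsp, hE]
    have h1 : ∫ ω, (a * (z ω * star (s ω))).re ∂μ = (a * A).re := by
      rw [← hA, ← integral_const_mul]
      exact integral_re (hzs.const_mul a)
    have h2 : (a * A).re = ‖A‖ ^ 2 / Q := by
      have : a * A = ((‖A‖ ^ 2 / Q : ℝ) : ℂ) := by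
        rw [ha, div_mul_eq_mul_div, Complex.star_def, Complex.conj_mul']
        push_cast; rfl
      rw [this, Complex.ofReal_re]
    have h3 : ‖a‖ ^ 2 = ‖A‖ ^ 2 / Q ^ 2 := by
      rw [ha, norm_div, norm_star, div_pow, Complex.norm_real, Real.norm_eq_abs, sq_abs]
    rw [h1, h2, h3, hv]
    field_simp
    rw [hQ]; ring
  have herri : Integrable (fun ω => ‖s ω - a * z ω‖ ^ 2) μ := by
    simp_rw [hexpand]
    exact (hsi.add (hzi.const_mul _)).sub (hre.const_mul 2)
  have hfi' : Integrable (fun ω => f (s ω, z ω)) μ :=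
    (hsi.sub (herri.div_const v)).sub (integrable_const _)
  have hfi : Integrable f (μ.map fun ω => (s ω, z ω)) :=
    (integrable_map_measure (by fun_prop) (by fun_prop)).mpr hfi'
  have hfv : ∫ p, f p ∂(μ.map fun ω => (s ω, z ω)) = Real.log (1 + ‖A‖ ^ 2 / D) := by
    rw [integral_map (by fun_prop) (by fun_prop)]
    simp only [hf]
    have hsub : Integrable (fun ω => ‖s ω‖ ^ 2 - ‖s ω - a * z ω‖ ^ 2 / v) μ :=
      hsi.sub (herri.div_const v)
    -- The power of `s` and the normalized error power both equal `1` and cancel, leaving `-log v`.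
    rw [integral_sub hsub (integrable_const _),
      integral_sub hsi (herri.div_const v), integral_div, hsp, herr, div_self hv0.ne']
    have h1 : 1 + ‖A‖ ^ 2 / D = v⁻¹ := by
      rw [hv, inv_div, hQ]; field_simp; ring
    rw [h1, Real.log_inv]
    simp
  rw [← hfv]
  exact ofReal_integral_le_klDiv hfi hi hone

end MutualInformation

-- Achievability of the spectral efficiency.

section Achievability

variable {L K M τ : ℕ} [NeZero K] {Ω : Type*} [MeasurableSpace Ω] {μ : Measure Ω}
  {P : Params L K M τ} {X : Block L K M τ Ω}

lemma Params.z_eq (s : Fin K → Ω → ℂ) (n : Ω → ℂ) (k : Fin K) (ω : Ω) :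
    P.z X μ s n k ω = ∑ t, s t ω * P.UI X μ k t ω + n ω := by
  simp only [Params.z, Params.x, Params.UI, dotProduct_sum, dotProduct_smul, smul_eq_mul,
    Finset.mul_sum]
  rw [Finset.sum_comm]
  congr 1
  exact Finset.sum_congr rfl fun t _ => Finset.sum_congr rfl fun l _ => by ring

/-- The received signal has correlation `CP` with the desired symbol, and its power is `|CP|²` plus
the denominator of the SINR. These are the only data the Gaussian-input bound requires. -/
lemma Params.IsValid.SE_le_mutualInfo [IsProbabilityMeasure μ] (hP : P.IsValid)
    (hX : X.IsRayleigh μ) (k : Fin K) {s : Fin K → Ω → ℂ} {n : Ω → ℂ}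
    (hs : IsDownlinkInput X μ k s n) :
    ENNReal.ofReal (P.SE X μ k) ≤ mutualInfo (s k) (P.z X μ s n k) μ := by
  have hsm := hs.measurable_s
  have hnm := hs.measurable_n
  have hfam : Measurable fun ω i => X.family i ω := measurable_pi_lambda _ hX.measurable
  set F : Fin K → (BlockIndex L K M τ → ℂ) → ℂ :=
    fun t z => ∑ l, (√(P.ρ l t) : ℂ) * gainFun P X μ l k t z with hF
  have hFm : ∀ t, Measurable (F t) := fun t =>
    Finset.measurable_fun_sum _ fun l _ => (measurable_gainFun hP l k t).const_mul _
  have hFU : ∀ t, P.UI X μ k t = fun ω => F t (fun i => X.family i ω) := fun t => rfl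
  have hUm : ∀ t, Measurable (P.UI X μ k t) := fun t => by
    rw [hFU]; exact (hFm t).comp hfam
  have hU2 := hP.memLp_UI hX k
  have hwhite : IsWhite s μ :=
    { memLp := fun t => by
        rw [memLp_two_iff_integrable_sq_norm (hsm t).aestronglyMeasurable]
        -- A symbol that is not square-integrable would have power integral `0`, not `1`.
        by_contra h
        have := hs.power t
        rw [integral_undef h] at this
        exact zero_ne_one this
      power := hs.power
      uncorrelated := hs.uncorrelated }
  have hind : IndepFun (fun ω t => s t ω) (fun ω t => P.UI X μ k t ω) μ := by
    have h := hs.indep_s.comp (φ := id)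
      (ψ := fun (z : BlockIndex L K M τ → ℂ) t => F t z) measurable_id
      (measurable_pi_lambda _ hFm)
    exact h
  set y : Ω → ℂ := fun ω => ∑ t, s t ω * P.UI X μ k t ω with hy
  have hy2 : MemLp y 2 μ := hwhite.memLp_sum_mul hU2 hind
  have hyE : ∫ ω, ‖y ω‖ ^ 2 ∂μ = ∑ t, ∫ ω, ‖P.UI X μ k t ω‖ ^ 2 ∂μ :=
    hwhite.integral_norm_sum_mul_sq hU2 hind
  have hn2 : MemLp n 2 μ := by
    have h := memLp_id_stdComplexGaussian
    rw [← hs.law_n, memLp_map_measure_iff (by fun_prop) hnm.aemeasurable] at h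
    exact h
  have hnp : ∫ ω, ‖n ω‖ ^ 2 ∂μ = 1 := by
    rw [← integral_norm_sq_stdComplexGaussian, ← hs.law_n,
      integral_map hnm.aemeasurable (by fun_prop)]
  have hn0 : ∫ ω, n ω ∂μ = 0 := by
    rw [← integral_id_stdComplexGaussian, ← hs.law_n,
      integral_map hnm.aemeasurable (by fun_prop)]
  have hny : IndepFun n y μ := by
    have h := hs.indep_n.comp (φ := id)
      (ψ := fun p : (Fin K → ℂ) × (BlockIndex L K M τ → ℂ) => ∑ t, p.1 t * F t p.2) measurable_id
      (Finset.measurable_fun_sum _ fun t _ => Measurable.mul (by fun_prop)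
        ((hFm t).comp measurable_snd))
    exact h
  have hns : IndepFun n (s k) μ :=
    hs.indep_n.comp (φ := id)
      (ψ := fun p : (Fin K → ℂ) × (BlockIndex L K M τ → ℂ) => p.1 k) measurable_id (by fun_prop)
  have hz : P.z X μ s n k = fun ω => y ω + n ω := funext fun ω => P.z_eq s n k ω
  have hym : Measurable y := by fun_prop
  have hyn : ∫ ω, y ω * star (n ω) ∂μ = 0 := by
    have h1 : IndepFun (fun ω => star (n ω)) y μ :=
      hny.comp (φ := fun x : ℂ => star x) (ψ := id) (by fun_prop) measurable_id
    simp_rw [mul_comm (y _)]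
    rw [h1.integral_fun_mul_eq_mul_integral hn2.star.1 hy2.1]
    simp only [Complex.star_def]
    rw [integral_conj, hn0, map_zero, zero_mul]
  have hUI1 : ∫ ω, P.UI X μ k k ω ∂μ = P.CP X μ k := by
    unfold Params.UI Params.CP
    rw [integral_finsetSum _ fun l _ =>
      (((hP.gain hX l k k).1.integrable (by norm_num)).const_mul _)]
    exact Finset.sum_congr rfl fun l _ => integral_const_mul _ _
  have hUI2 : ∫ ω, ‖P.UI X μ k k ω‖ ^ 2 ∂μ
      = ‖P.CP X μ k‖ ^ 2 + ∫ ω, ‖P.PU X μ k ω‖ ^ 2 ∂μ := by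
    have h := integral_norm_sub_integral_sq (hU2 k)
    rw [hUI1] at h
    have h2 : ∀ ω, P.UI X μ k k ω - P.CP X μ k = P.PU X μ k ω := fun ω => by
      simp only [Params.UI, Params.CP, Params.PU, Finset.sum_sub_distrib]
    simp_rw [h2] at h
    linarith
  set D : ℝ := (∫ ω, ‖P.PU X μ k ω‖ ^ 2 ∂μ)
    + (∑ t ∈ Finset.univ.erase k, ∫ ω, ‖P.UI X μ k t ω‖ ^ 2 ∂μ) + 1 with hD
  have hD0 : 0 < D := by
    have h1 : 0 ≤ ∫ ω, ‖P.PU X μ k ω‖ ^ 2 ∂μ := integral_nonneg fun ω => by positivity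
    have h2 : 0 ≤ ∑ t ∈ Finset.univ.erase k, ∫ ω, ‖P.UI X μ k t ω‖ ^ 2 ∂μ :=
      Finset.sum_nonneg fun t _ => integral_nonneg fun ω => by positivity
    linarith
  have hE : ∫ ω, ‖y ω + n ω‖ ^ 2 ∂μ = ‖P.CP X μ k‖ ^ 2 + D := by
    rw [integral_norm_add_sq hy2 hn2 hyn, hyE, hnp,
      ← Finset.add_sum_erase _ _ (Finset.mem_univ k), hUI2, hD]
    ring
  -- Independence of symbols and channels factors each term into a symbol correlation and a mean
  -- gain; only `t = k` survives.
  have hA : ∫ ω, (y ω + n ω) * star (s k ω) ∂μ = P.CP X μ k := by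
    simp_rw [add_mul]
    rw [integral_add (integrable_mul_star hy2 (hwhite.memLp k))
      (integrable_mul_star hn2 (hwhite.memLp k))]
    have h1 : ∫ ω, n ω * star (s k ω) ∂μ = 0 := by
      have h1 : IndepFun n (fun ω => star (s k ω)) μ :=
        hns.comp (φ := id) (ψ := fun x : ℂ => star x) measurable_id (by fun_prop)
      rw [h1.integral_fun_mul_eq_mul_integral hn2.1 (hwhite.memLp k).star.1, hn0, zero_mul]
    have hmul : ∀ t, MemLp (fun ω => s t ω * P.UI X μ k t ω) 2 μ := fun t =>
      memLp_two_mul_of_indepFun (hind.comp (φ := fun z : Fin K → ℂ => z t)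
        (ψ := fun z : Fin K → ℂ => z t) (by fun_prop) (by fun_prop)) (hwhite.memLp t) (hU2 t)
    have h2 : ∀ t, ∫ ω, s t ω * P.UI X μ k t ω * star (s k ω) ∂μ
        = (∫ ω, s t ω * star (s k ω) ∂μ) * ∫ ω, P.UI X μ k t ω ∂μ := fun t => by
      have h3 : IndepFun (fun ω => s t ω * star (s k ω)) (P.UI X μ k t) μ :=
        hind.comp (φ := fun z : Fin K → ℂ => z t * star (z k)) (ψ := fun z : Fin K → ℂ => z t)
          (by fun_prop) (by fun_prop)
      simp_rw [mul_right_comm]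
      exact h3.integral_fun_mul_eq_mul_integral
        (integrable_mul_star (hwhite.memLp t) (hwhite.memLp k)).1 (hU2 t).1
    have h3 : ∫ ω, s k ω * star (s k ω) ∂μ = 1 := by
      have h4 : ∀ ω, s k ω * star (s k ω) = ((‖s k ω‖ ^ 2 : ℝ) : ℂ) := fun ω => by
        rw [Complex.star_def, Complex.mul_conj']; push_cast; rfl
      simp_rw [h4]
      rw [integral_complex_ofReal, hs.power, Complex.ofReal_one]
    simp_rw [hy, Finset.sum_mul]
    rw [h1, add_zero, integral_finsetSum _ fun t _ =>
      integrable_mul_star (hmul t) (hwhite.memLp k)]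
    simp_rw [h2]
    rw [Finset.sum_eq_single k (fun t _ ht => by rw [hs.uncorrelated t k ht, zero_mul]) (by simp),
      h3, one_mul, hUI1]
  have key := ofReal_log_le_klDiv (hsm k) (hym.add hnm) hs.law_s (hy2.add hn2) hA hD0 hE
  rw [mutualInfo, hz, Params.SE, Params.SINR, Real.logb,
    ENNReal.ofReal_div_of_pos (Real.log_pos one_lt_two)]
  exact ENNReal.div_le_div_right key _

end Achievability

end CellFree

end

theorem proposition1 {L K M τ : ℕ} [NeZero K]
    {Ω : Type*} [MeasurableSpace Ω] (μ : Measure Ω) [IsProbabilityMeasure μ]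
    (P : CellFree.Params L K M τ) (X : CellFree.Block L K M τ Ω)
    (hβ : ∀ l k, 0 < P.β l k) (hβE : ∀ l, 0 ≤ P.βE l)
    (hρu : 0 < P.ρu) (hρE : 0 ≤ P.ρE) (hρ : ∀ l k, 0 ≤ P.ρ l k)
    (hφ : Orthonormal ℂ P.φ) (hS : ∀ l, (P.S l).card < M)
    (hX : X.IsRayleigh μ) (k : Fin K) :
    -- the precoding vectors have unit mean power, and all expectations in the SINR exist
    (∀ l t, Integrable (fun ω => ∑ m, ‖P.w X μ l t ω m‖ ^ 2) μ ∧
      ∫ ω, ∑ m, ‖P.w X μ l t ω m‖ ^ 2 ∂μ = 1) ∧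
    (∀ l, Integrable (fun ω => star (P.h X l k ω) ⬝ᵥ P.w X μ l k ω) μ) ∧
    Integrable (fun ω => ‖P.PU X μ k ω‖ ^ 2) μ ∧
    (∀ t, Integrable (fun ω => ‖P.UI X μ k t ω‖ ^ 2) μ) ∧
    -- closed form of the SINR and of the spectral efficiency
    P.SINR X μ k =
      (∑ l, √(((M : ℝ) - (P.S l).card) * P.ρ l k * P.γ l k)) ^ 2 /
        (∑ t, ∑ l, P.ρ l t * (P.β l k - P.δ l k * P.γ l k) + 1) ∧
    P.SE X μ k = Real.logb 2 (1 +
      (∑ l, √(((M : ℝ) - (P.S l).card) * P.ρ l k * P.γ l k)) ^ 2 /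
        (∑ t, ∑ l, P.ρ l t * (P.β l k - P.δ l k * P.γ l k) + 1)) ∧
    -- the spectral efficiency is achievable
    (∀ (s : Fin K → Ω → ℂ) (n : Ω → ℂ), CellFree.IsDownlinkInput X μ k s n →
      ENNReal.ofReal (P.SE X μ k) ≤ CellFree.mutualInfo (s k) (P.z X μ s n k) μ) := by
  have hP : P.IsValid := ⟨hβ, hβE, hρu, hρE, hρ, hφ, hS⟩
  refine ⟨fun l t => hP.integral_w hX l t,
    fun l => (hP.gain hX l k k).1.integrable (by norm_num), ?_, fun t => ?_, hP.SINR_eq hX k, ?_,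
    fun s n hs => hP.SE_le_mutualInfo hX k hs⟩
  · exact (memLp_two_iff_integrable_sq_norm (hP.memLp_PU hX k).1).mp (hP.memLp_PU hX k)
  · exact (memLp_two_iff_integrable_sq_norm (hP.memLp_UI hX k t).1).mp (hP.memLp_UI hX k t)
  · rw [CellFree.Params.SE, hP.SINR_eq hX k]
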